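/- Let $d\ge 1$. A set $X\subseteq\mathbb{R}^d$ is a Delone set with parameters $(r,R)$, $r,R>0$, if $r$ is the largest positive number such that every open ball of radius $r$ contains at most one point of $X$, and $R$ is the smallest positive number such that every closed ball of radius $R$ contains at least one point of $X$. For $x\in X$ and $\rho\ge 0$ the $\rho$-cluster at $x$ is $C_x(\rho)=\{y\in X:\|y-x\|\le\rho\}$. The set $X$ is $\rho$-isometric if for all $x,x'\in X$ there is an isometry of $\mathbb{R}^d$ mapping $x$ to $x'$ and $C_x(\rho)$ onto $C_{x'}(\rho)$; it is a regular system if its group of symmetries acts transitively on $X$. The kissing number $\tau_d$ is the maximum number of mutually non-overlapping unit balls in $\mathbb{R}^d$ that touch a given unit ball without overlapping it. For a family $\mathcal{X}$ of Delone sets with the same parameters, the regularity radius $\hat\rho_d(\mathcal{X})$ is the infimum of the numbers $\rho>0$ such that every $\rho$-isometric $X\in\mathcal{X}$ is a regular system. There is a sequence $\varepsilon_d$ of real numbers, depending only on $d$, with $\varepsilon_d\to 0$ as $d\to\infty$, such that $4+0.8022\,d^2(1+\varepsilon_d)=O(d^2)$ and the following holds for all $d\ge 1$ and all $r,R>0$.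 Let $\mathcal{X}=\mathcal{X}_d(r,R)$ be the family of $2R$-isometric Delone sets $X\subset\mathbb{R}^d$ with parameters $(r,R)$ such that the minimal-distance cluster $M_x(1)=C_x(2r)$ is full-dimensional (its affine hull is $\mathbb{R}^d$) for some $x\in X$. Then for every $X\in\mathcal{X}$ the cluster $M_x(1)$ is full-dimensional for all $x\in X$; every member of $\mathcal{X}$ that is $2(d\log_2\tau_d+2)R$-isometric is a regular system; and $$\hat\rho_d(\mathcal{X})\;\le\;2(d\log_2\tau_d+2)R\;\le\;\bigl(4+0.8022\,d^2(1+\varepsilon_d)\bigr)R .$$ -/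

import Mathlib

open Metric Filter Topology Asymptotics

/-- `X` is a Delone set in `ℝ^d` with exact parameters `(r, R)`: `r` is the largest positive number
such that every open ball of radius `r` contains at most one point of `X`, and `R` is the smallest
positive number such that every closed ball of radius `R` contains at least one point of `X`. -/
structure IsDelone {d : ℕ} (r R : ℝ) (X : Set (EuclideanSpace ℝ (Fin d))) : Prop where
  packing : IsGreatest
    {s : ℝ | 0 < s ∧ ∀ c : EuclideanSpace ℝ (Fin d), (X ∩ ball c s).Subsingleton} r
  covering : IsLeast
    {S : ℝ | 0 < S ∧ ∀ c : EuclideanSpace ℝ (Fin d), (X ∩ closedBall c S).Nonempty} R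

/-- The cluster `C_x(ρ) = X ∩ B_x(ρ)` of radius `ρ` with center `x`. -/
def cluster {d : ℕ} (X : Set (EuclideanSpace ℝ (Fin d))) (x : EuclideanSpace ℝ (Fin d)) (ρ : ℝ) :
    Set (EuclideanSpace ℝ (Fin d)) :=
  X ∩ closedBall x ρ

/-- The `ρ`-clusters of `X` at `x` and `y` are equivalent: an isometry of the whole space maps
`x` to `y` and `C_x(ρ)` onto `C_y(ρ)`. -/
def ClustersEquivalent {d : ℕ} (X : Set (EuclideanSpace ℝ (Fin d))) (ρ : ℝ)
    (x y : EuclideanSpace ℝ (Fin d)) : Prop :=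
  ∃ g : EuclideanSpace ℝ (Fin d) ≃ᵢ EuclideanSpace ℝ (Fin d),
    g x = y ∧ g '' cluster X x ρ = cluster X y ρ

/-- `X` is `ρ`-isometric: any two `ρ`-clusters of `X` are equivalent. -/
def IsRadiusIsometric {d : ℕ} (ρ : ℝ) (X : Set (EuclideanSpace ℝ (Fin d))) : Prop :=
  ∀ x ∈ X, ∀ y ∈ X, ClustersEquivalent X ρ x y

/-- The symmetry group of `X` acts transitively on `X`. -/
def IsRegularSystem {d : ℕ} (X : Set (EuclideanSpace ℝ (Fin d))) : Prop :=
  ∀ x ∈ X, ∀ y ∈ X, ∃ g : EuclideanSpace ℝ (Fin d) ≃ᵢ EuclideanSpace ℝ (Fin d),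
    g '' X = X ∧ g x = y

/-- A subset of `ℝ^d` is full-dimensional if its affine hull is the whole space. -/
def IsFullDimensional {d : ℕ} (M : Set (EuclideanSpace ℝ (Fin d))) : Prop :=
  affineSpan ℝ M = ⊤

/-- The positive numbers `ρ` such that each `ρ`-isometric member of the family `F` is a regular
system. -/
def regularityRadii {d : ℕ} (F : Set (Set (EuclideanSpace ℝ (Fin d)))) : Set ℝ :=
  {ρ : ℝ | 0 < ρ ∧ ∀ X ∈ F, IsRadiusIsometric ρ X → IsRegularSystem X}

/-- The regularity radius of the family `F`. -/
noncomputable def regularityRadius {d : ℕ} (F : Set (Set (EuclideanSpace ℝ (Fin d)))) : ℝ :=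
  sInf (regularityRadii F)

/-- The `2R`-isometric Delone sets with parameters `(r, R)` for which the set
`M_x(1) = C_x(2r)` is full-dimensional for some point `x` of the set. -/
def minClusterFamily (d : ℕ) (r R : ℝ) : Set (Set (EuclideanSpace ℝ (Fin d))) :=
  {X | IsDelone r R X ∧ IsRadiusIsometric (2 * R) X ∧
    ∃ x ∈ X, IsFullDimensional (cluster X x (2 * r))}

/-- `s` is the set of centers of mutually non-overlapping unit balls in `ℝ^d`, each of which touches
the unit ball centered at `0` (without overlapping it). -/
def IsKissingConfiguration {d : ℕ} (s : Finset (EuclideanSpace ℝ (Fin d))) : Prop :=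
  (∀ c ∈ s, Disjoint (ball c 1) (ball 0 1) ∧ (closedBall c 1 ∩ closedBall 0 1).Nonempty) ∧
  ∀ c ∈ s, ∀ c' ∈ s, c ≠ c' → Disjoint (ball c 1) (ball c' 1)

/-- The kissing number `τ_d`: the maximum size of a kissing configuration. -/
noncomputable def kissingNumber (d : ℕ) : ℕ :=
  sSup {n : ℕ | ∃ s : Finset (EuclideanSpace ℝ (Fin d)), IsKissingConfiguration s ∧ s.card = n}

/-- The set whose supremum defines `kissingNumber` is bounded, so the supremum is a maximum. -/
theorem kissingNumber_isGreatest (d : ℕ) :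
    IsGreatest {n : ℕ | ∃ s : Finset (EuclideanSpace ℝ (Fin d)),
      IsKissingConfiguration s ∧ s.card = n} (kissingNumber d) := by
  have hb : BddAbove {n : ℕ | ∃ s : Finset (EuclideanSpace ℝ (Fin d)),
      IsKissingConfiguration s ∧ s.card = n} := by
    obtain ⟨t, -, ht, hcov⟩ := finite_cover_balls_of_compact
      (isCompact_closedBall (0 : EuclideanSpace ℝ (Fin d)) 2) (e := 1) one_pos
    refine ⟨ht.toFinset.card, ?_⟩
    rintro n ⟨s, ⟨h1, h2⟩, rfl⟩
    have hex : ∀ c ∈ s, ∃ y ∈ t, c ∈ ball y 1 := by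
      intro c hc
      obtain ⟨z, hz1, hz2⟩ := (h1 c hc).2
      have hc2 : c ∈ closedBall (0 : EuclideanSpace ℝ (Fin d)) 2 := by
        rw [mem_closedBall] at *
        have := dist_triangle_left c 0 z
        linarith
      simpa using hcov hc2
    choose! f hft hf using hex
    refine Finset.card_le_card_of_injOn f (fun c hc => by simpa using hft c hc) ?_
    intro c hc c' hc' hcc
    by_contra hne
    have m1 : f c ∈ ball c 1 := mem_ball_comm.1 (hf c hc)
    have m2 : f c ∈ ball c' 1 := by
      rw [hcc]
      exact mem_ball_comm.1 (hf c' hc')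
    exact Set.disjoint_left.1 (h2 c hc c' hc' hne) m1 m2
  exact ⟨Nat.sSup_mem ⟨0, ∅, by simp [IsKissingConfiguration], by simp⟩ hb,
    fun n hn => le_csSup hb hn⟩

/-! The local theory of regular systems reduces transitivity of the symmetry group to two conditions
at one radius `ρ`: all clusters of radius `ρ + 2R` are equivalent, and the group of the cluster at a
point is the same at radius `ρ` as at `ρ + 2R`. An isometry matching two large clusters then
propagates along chains with steps at most `2R` and preserves `X`
(`IsDelone.isRegularSystem_of_clusterGroup_le`).

Full dimension of the minimal-distance cluster makes the group at radius `2R` finite: an isometry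
fixing `x` is affine, hence determined by the images of `d` spanning neighbours, each with at most
`τ_d` possible images. So the order is at most `τ_d ^ d`. The groups at radii `2R, 4R, 6R, …`
decrease and each strict step at least halves the order, so two consecutive groups coincide after at
most `d log₂ τ_d` steps. This gives the radius `2 (d log₂ τ_d + 2) R`.

The numerical bound needs `log₂ τ_d ≤ 0.4011 d` for large `d`, the Kabatiansky–Levenshtein estimate.
Gegenbauer kernels are Gram kernels on the sphere (`exists_gegenbauer_eq_sum`), which yields a
linear programming bound for codes with inner products at most `0.4581`
(`exists_card_le_mul_choose`). Averaging over thin cylinders (`card_mul_pow_le_of_one_le_dist`)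
passes from such codes to kissing configurations, and `exponent_lt` checks the resulting rate. -/

/-! ### Clusters, their groups, and the local criterion for regularity. -/

section Clusters

variable {d : ℕ} {X : Set (EuclideanSpace ℝ (Fin d))}

theorem IsDelone.two_mul_le_dist {r R : ℝ} (h : IsDelone r R X) {x y : EuclideanSpace ℝ (Fin d)}
    (hx : x ∈ X) (hy : y ∈ X) (hxy : x ≠ y) : 2 * r ≤ dist x y := by
  by_contra! hlt
  refine hxy (h.packing.1.2 (midpoint ℝ x y) ⟨hx, ?_⟩ ⟨hy, ?_⟩)
  · rw [mem_ball, dist_left_midpoint]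
    norm_num
    linarith
  · rw [mem_ball, dist_right_midpoint]
    norm_num
    linarith

theorem mem_cluster {x y : EuclideanSpace ℝ (Fin d)} {ρ : ℝ} :
    y ∈ cluster X x ρ ↔ y ∈ X ∧ dist y x ≤ ρ := Iff.rfl

/-- An isometry carrying a cluster onto a cluster carries concentric smaller clusters onto
each other. -/
theorem image_cluster_of_le {x y : EuclideanSpace ℝ (Fin d)} {ρ ρ' : ℝ} (h : ρ ≤ ρ')
    {g : EuclideanSpace ℝ (Fin d) ≃ᵢ EuclideanSpace ℝ (Fin d)} (hg : g x = y)
    (hc : g '' cluster X x ρ' = cluster X y ρ') : g '' cluster X x ρ = cluster X y ρ := by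
  have key : ∀ z, (g z ∈ X ∧ dist z x ≤ ρ') ↔ (z ∈ X ∧ dist z x ≤ ρ') := by
    intro z
    have : g z ∈ g '' cluster X x ρ' ↔ z ∈ cluster X x ρ' := g.injective.mem_set_image
    rw [hc, mem_cluster, mem_cluster, ← hg, g.isometry.dist_eq] at this
    exact this
  ext w
  obtain ⟨z, rfl⟩ := g.surjective w
  rw [g.injective.mem_set_image, mem_cluster, mem_cluster, ← hg, g.isometry.dist_eq]
  constructor
  · exact fun hz => ⟨((key z).2 ⟨hz.1, hz.2.trans h⟩).1, hz.2⟩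
  · exact fun hz => ⟨((key z).1 ⟨hz.1, hz.2.trans h⟩).1, hz.2⟩

theorem IsRadiusIsometric.mono {ρ ρ' : ℝ} (h : ρ ≤ ρ') (hX : IsRadiusIsometric ρ' X) :
    IsRadiusIsometric ρ X := fun x hx y hy => by
  obtain ⟨g, hg, hc⟩ := hX x hx y hy
  exact ⟨g, hg, image_cluster_of_le h hg hc⟩

/-- The group of isometries fixing `x` and preserving the `ρ`-cluster at `x`. -/
def clusterGroup (X : Set (EuclideanSpace ℝ (Fin d))) (x : EuclideanSpace ℝ (Fin d)) (ρ : ℝ) :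
    Subgroup (EuclideanSpace ℝ (Fin d) ≃ᵢ EuclideanSpace ℝ (Fin d)) where
  carrier := {g | g x = x ∧ g '' cluster X x ρ = cluster X x ρ}
  one_mem' := ⟨rfl, by simp⟩
  mul_mem' := by
    rintro g h ⟨hg, hg'⟩ ⟨hh, hh'⟩
    refine ⟨by simp [hg, hh], ?_⟩
    rw [IsometryEquiv.coe_mul, Set.image_comp, hh', hg']
  inv_mem' := by
    rintro g ⟨hg, hg'⟩
    have h1 : ∀ z, g⁻¹ (g z) = z := fun z => IsometryEquiv.inv_apply_self g z
    refine ⟨by nth_rw 1 [← hg]; exact h1 x, ?_⟩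
    nth_rw 1 [← hg']
    rw [← Set.image_comp]
    simp

theorem mem_clusterGroup {x : EuclideanSpace ℝ (Fin d)} {ρ : ℝ}
    {g : EuclideanSpace ℝ (Fin d) ≃ᵢ EuclideanSpace ℝ (Fin d)} :
    g ∈ clusterGroup X x ρ ↔ g x = x ∧ g '' cluster X x ρ = cluster X x ρ := Iff.rfl

theorem clusterGroup_anti {x : EuclideanSpace ℝ (Fin d)} {ρ ρ' : ℝ} (h : ρ ≤ ρ') :
    clusterGroup X x ρ' ≤ clusterGroup X x ρ :=
  fun _ hg => ⟨hg.1, image_cluster_of_le h hg.1 hg.2⟩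

open scoped Pointwise in
/-- Any two points of a Delone set are joined by a chain of points of the set with steps of
length at most `2R`; stated as an induction principle. -/
theorem IsDelone.induction_on {r R : ℝ} (h : IsDelone r R X) (P : EuclideanSpace ℝ (Fin d) → Prop)
    {x : EuclideanSpace ℝ (Fin d)} (hx : x ∈ X) (hPx : P x)
    (step : ∀ a ∈ X, P a → ∀ b ∈ X, dist b a ≤ 2 * R → P b) : ∀ y ∈ X, P y := by
  intro y hy
  by_contra hPy
  have closed : ∀ S ⊆ X, IsClosed (S + closedBall (0 : EuclideanSpace ℝ (Fin d)) R) := by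
    intro S hS
    refine IsClosed.add_right_of_isCompact ?_ (isCompact_closedBall 0 R)
    refine Metric.isClosed_of_pairwise_le_dist (ε := 2 * r) (by linarith [h.packing.1.1]) ?_
    exact fun a ha b hb hab => h.two_mul_le_dist (hS ha) (hS hb) hab
  have mem : ∀ (S : Set (EuclideanSpace ℝ (Fin d))) (c : EuclideanSpace ℝ (Fin d)),
      c ∈ S + closedBall (0 : EuclideanSpace ℝ (Fin d)) R ↔ ∃ a ∈ S, dist a c ≤ R := by
    intro S c
    rw [Set.mem_add]
    constructor
    · rintro ⟨a, ha, b, hb, rfl⟩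
      exact ⟨a, ha, by simpa [dist_eq_norm] using hb⟩
    · rintro ⟨a, ha, hac⟩
      exact ⟨a, ha, c - a, by simpa [dist_eq_norm, norm_sub_rev] using hac, by simp⟩
  -- The closed `R`-balls around points with `P`, and those around points without `P`, form two
  -- nonempty closed sets covering the connected space. They share a point `c`, so some pair of
  -- centers from the two classes is at distance at most `2R`.
  have hcon := isPreconnected_closed_iff.1
    (isPreconnected_univ (α := EuclideanSpace ℝ (Fin d)))
    _ _ (closed {a ∈ X | P a} fun a ha => ha.1) (closed {a ∈ X | ¬ P a} fun a ha => ha.1)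
    (fun c _ => by
      obtain ⟨a, ha, hac⟩ := h.covering.1.2 c
      by_cases hPa : P a
      · exact Or.inl ((mem _ _).2 ⟨a, ⟨ha, hPa⟩, hac⟩)
      · exact Or.inr ((mem _ _).2 ⟨a, ⟨ha, hPa⟩, hac⟩))
    ⟨x, trivial, (mem _ _).2 ⟨x, ⟨hx, hPx⟩, by simpa using h.covering.1.1.le⟩⟩
    ⟨y, trivial, (mem _ _).2 ⟨y, ⟨hy, hPy⟩, by simpa using h.covering.1.1.le⟩⟩
  obtain ⟨c, -, hc1, hc2⟩ := hcon
  obtain ⟨a, ⟨ha, hPa⟩, hac⟩ := (mem _ _).1 hc1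
  obtain ⟨b, ⟨hb, hPb⟩, hbc⟩ := (mem _ _).1 hc2
  refine hPb (step a ha hPa b hb ?_)
  linarith [dist_triangle_right b a c]

/-- The local criterion: if the clusters of radius `ρ + 2R` are equivalent and the cluster groups
do not shrink between the radii `ρ` and `ρ + 2R`, the Delone set is a regular system. -/
theorem IsDelone.isRegularSystem_of_clusterGroup_le {r R ρ : ℝ} (h : IsDelone r R X) (hρ : 0 ≤ ρ)
    (hX : IsRadiusIsometric (ρ + 2 * R) X)
    (hG : ∀ x ∈ X, clusterGroup X x ρ ≤ clusterGroup X x (ρ + 2 * R)) : IsRegularSystem X := by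
  have hR := h.covering.1.1
  have ext : ∀ g : EuclideanSpace ℝ (Fin d) ≃ᵢ EuclideanSpace ℝ (Fin d), ∀ x ∈ X, g x ∈ X →
      g '' cluster X x (ρ + 2 * R) = cluster X (g x) (ρ + 2 * R) → ∀ y ∈ X, g y ∈ X := by
    intro g x hx hgx hgc y hy
    refine (h.induction_on (fun y => g y ∈ X ∧
      g '' cluster X y (ρ + 2 * R) = cluster X (g y) (ρ + 2 * R)) hx ⟨hgx, hgc⟩ ?_ y hy).1
    rintro a ha ⟨hga, hac⟩ b hb hab
    have key : ∀ z, dist z a ≤ ρ + 2 * R → (g z ∈ X ↔ z ∈ X) := by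
      intro z hz
      have : g z ∈ g '' cluster X a (ρ + 2 * R) ↔ z ∈ cluster X a (ρ + 2 * R) :=
        g.injective.mem_set_image
      rw [hac, mem_cluster, mem_cluster, g.isometry.dist_eq] at this
      simpa [hz] using this
    have hgb : g b ∈ X := (key b (by linarith)).2 hb
    refine ⟨hgb, ?_⟩
    -- The `ρ`-ball at `b` lies in the `(ρ + 2R)`-ball at `a`, where `g` already respects `X`.
    have small : g '' cluster X b ρ = cluster X (g b) ρ := by
      ext w
      obtain ⟨z, rfl⟩ := g.surjective w
      rw [g.injective.mem_set_image, mem_cluster, mem_cluster, g.isometry.dist_eq]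
      refine and_congr_left fun hz => (key z ?_).symm
      linarith [dist_triangle z b a]
    obtain ⟨k, hk, hkc⟩ := hX b hb (g b) hgb
    have hks := image_cluster_of_le (by linarith : ρ ≤ ρ + 2 * R) hk hkc
    -- `g` and the given equivalence `k` agree at `b` up to a symmetry of the `ρ`-cluster; by
    -- stability this is a symmetry of the `(ρ + 2R)`-cluster, so `g` matches the large clusters
    -- because `k` does.
    have hmem : k⁻¹ * g ∈ clusterGroup X b ρ := by
      refine ⟨?_, ?_⟩
      · rw [IsometryEquiv.coe_mul, Function.comp_apply, ← hk]
        exact IsometryEquiv.inv_apply_self k b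
      · rw [IsometryEquiv.coe_mul, Set.image_comp, small, ← hks, ← Set.image_comp]
        simp
    have hbig := (hG b hb hmem).2
    have : ⇑g = ⇑k ∘ ⇑(k⁻¹ * g) := by
      rw [← IsometryEquiv.coe_mul, mul_inv_cancel_left]
    rw [this, Set.image_comp, hbig, hkc, ← this]
  intro x hx y hy
  obtain ⟨g, hg, hgc⟩ := hX x hx y hy
  subst hg
  refine ⟨g, Set.Subset.antisymm ?_ ?_, rfl⟩
  · rintro _ ⟨z, hz, rfl⟩
    exact ext g x hx hy hgc z hz
  · intro z hz
    refine ⟨g⁻¹ z, ext g⁻¹ (g x) hy ?_ ?_ z hz, IsometryEquiv.apply_inv_self g z⟩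
    · rwa [IsometryEquiv.inv_apply_self]
    · rw [IsometryEquiv.inv_apply_self, ← hgc, ← Set.image_comp]
      simp

end Clusters

/-! ### Order of the cluster group and the regularity radius in terms of the kissing number. -/

section Regularity

variable {d : ℕ} {X : Set (EuclideanSpace ℝ (Fin d))}

theorem card_le_kissingNumber (s : Finset (EuclideanSpace ℝ (Fin d))) (h : ∀ c ∈ s, ‖c‖ = 2)
    (h2 : ∀ c ∈ s, ∀ c' ∈ s, c ≠ c' → 2 ≤ dist c c') : s.card ≤ kissingNumber d := by
  refine (kissingNumber_isGreatest d).2 ⟨s, ⟨fun c hc => ⟨?_, ?_⟩, fun c hc c' hc' hne => ?_⟩, rfl⟩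
  · rw [disjoint_ball_ball_iff one_pos one_pos, dist_zero_right, h c hc]
    norm_num
  · refine ⟨(1 / 2 : ℝ) • c, ?_, ?_⟩
    · have : (1 / 2 : ℝ) • c - c = (-(1 / 2) : ℝ) • c := by module
      rw [mem_closedBall, dist_eq_norm, this, norm_smul, h c hc]
      norm_num
    · rw [mem_closedBall, dist_zero_right, norm_smul, h c hc]
      norm_num
  · rw [disjoint_ball_ball_iff one_pos one_pos]
    linarith [h2 c hc c' hc' hne]

/-- By the packing condition the other points of the minimal-distance cluster lie at distance
exactly `2r` from `x`, so recentering and scaling by `r⁻¹` gives a kissing configuration. -/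
theorem IsDelone.card_le_kissingNumber {r R : ℝ} (h : IsDelone r R X)
    {x : EuclideanSpace ℝ (Fin d)} (hx : x ∈ X) (s : Finset (EuclideanSpace ℝ (Fin d)))
    (hs : (s : Set (EuclideanSpace ℝ (Fin d))) ⊆ cluster X x (2 * r) \ {x}) :
    s.card ≤ kissingNumber d := by
  classical
  have hr : 0 < r := h.packing.1.1
  have hinj : Function.Injective fun y : EuclideanSpace ℝ (Fin d) => r⁻¹ • (y - x) := by
    intro y z hyz
    simpa using smul_right_injective _ (inv_ne_zero hr.ne') hyz
  rw [← Finset.card_image_of_injective s hinj]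
  refine _root_.card_le_kissingNumber _ ?_ ?_
  · simp only [Finset.mem_image]
    rintro _ ⟨y, hy, rfl⟩
    have hy' := hs hy
    have : ‖y - x‖ = 2 * r := by
      rw [← dist_eq_norm]
      exact le_antisymm hy'.1.2 (h.two_mul_le_dist hy'.1.1 hx hy'.2)
    rw [norm_smul, this, norm_inv, Real.norm_of_nonneg hr.le]
    field_simp
  · simp only [Finset.mem_image]
    rintro _ ⟨y, hy, rfl⟩ _ ⟨z, hz, rfl⟩ hne
    have hyz : y ≠ z := fun e => hne (by rw [e])
    have := h.two_mul_le_dist (hs hy).1.1 (hs hz).1.1 hyz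
    rw [dist_smul₀, dist_sub_right, norm_inv, Real.norm_of_nonneg hr.le, inv_mul_eq_div,
      le_div_iff₀ hr]
    exact this

theorem IsDelone.finite_minCluster {r R : ℝ} (h : IsDelone r R X)
    {x : EuclideanSpace ℝ (Fin d)} (hx : x ∈ X) : (cluster X x (2 * r) \ {x}).Finite := by
  by_contra hinf
  obtain ⟨t, ht, htc⟩ := Set.Infinite.exists_subset_card_eq hinf (kissingNumber d + 1)
  have := h.card_le_kissingNumber hx t ht
  omega

/-- A finite-order bound for the cluster group: an isometry in it is determined by the images of
`d` points of the minimal-distance cluster. -/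
theorem IsDelone.card_clusterGroup_le {r R : ℝ} (h : IsDelone r R X)
    {x : EuclideanSpace ℝ (Fin d)} (hx : x ∈ X) (hfull : IsFullDimensional (cluster X x (2 * r)))
    {ρ : ℝ} (hρ : 2 * r ≤ ρ) :
    Finite (clusterGroup X x ρ) ∧ Nat.card (clusterGroup X x ρ) ≤ kissingNumber d ^ d := by
  set M := cluster X x (2 * r) \ {x} with hM
  have hfin : M.Finite := h.finite_minCluster hx
  have := hfin.to_subtype
  have hMcard : Nat.card M ≤ kissingNumber d := by
    rw [Nat.card_coe_set_eq, Set.ncard_eq_toFinset_card _ hfin]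
    exact h.card_le_kissingNumber hx _ (by simp [hM])
  have hxM : x ∈ cluster X x (2 * r) := ⟨hx, mem_closedBall_self (by linarith [h.packing.1.1])⟩
  have hspan : Submodule.span ℝ ((fun y => y -ᵥ x) '' M) = ⊤ := by
    rw [hM, ← vectorSpan_eq_span_vsub_set_right_ne ℝ hxM, ← direction_affineSpan]
    rw [IsFullDimensional] at hfull
    rw [hfull, AffineSubspace.direction_top]
  have hbasis := Submodule.exists_fun_fin_finrank_span_eq ℝ ((fun y => y -ᵥ x) '' M)
  rw [hspan, finrank_top, finrank_euclideanSpace_fin] at hbasis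
  obtain ⟨f, hfM, hfspan, -⟩ := hbasis
  choose y hyM hyf using hfM
  let φ : clusterGroup X x ρ → Fin d → M := fun g i => ⟨g.1 (y i), by
    have hmem := mem_clusterGroup.1 (clusterGroup_anti hρ g.2)
    refine ⟨hmem.2 ▸ Set.mem_image_of_mem _ (hyM i).1, fun e => (hyM i).2 ?_⟩
    exact g.1.injective (e.trans hmem.1.symm)⟩
  have hφ : Function.Injective φ := by
    rintro ⟨g, hg⟩ ⟨k, hk⟩ hgk
    have hgy : ∀ i, g (y i) = k (y i) := fun i => congrArg Subtype.val (congrFun hgk i)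
    have hgx : g x = k x := hg.1.trans hk.1.symm
    -- Isometries of the space are affine (Mazur–Ulam), so agreement at `x` and on `d` vectors `y i
    -- - x` spanning the space forces equality.
    have hlin : g.toRealAffineIsometryEquiv.toAffineMap.linear =
        k.toRealAffineIsometryEquiv.toAffineMap.linear := by
      refine LinearMap.ext_on_range hfspan fun i => ?_
      rw [← hyf i, AffineMap.linearMap_vsub, AffineMap.linearMap_vsub]
      change g (y i) -ᵥ g x = k (y i) -ᵥ k x
      rw [hgy i, hgx]
    refine Subtype.ext (IsometryEquiv.ext fun z => ?_)
    have h1 := AffineMap.linearMap_vsub g.toRealAffineIsometryEquiv.toAffineMap z x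
    rw [hlin, AffineMap.linearMap_vsub] at h1
    change k z -ᵥ k x = g z -ᵥ g x at h1
    rw [hgx] at h1
    exact (vsub_left_injective _ h1).symm
  refine ⟨Finite.of_injective φ hφ, (Nat.card_le_card_of_injective φ hφ).trans ?_⟩
  rw [Nat.card_fun, Nat.card_fin]
  exact Nat.pow_le_pow_left hMcard d

/-- A strictly decreasing chain of subgroups has length at most the binary logarithm of the order
of its first member. -/
theorem Subgroup.exists_eq_succ_of_card_lt {G : Type*} [Group G] (H : ℕ → Subgroup G)
    (hH : ∀ j, H (j + 1) ≤ H j) [Finite (H 0)] {m : ℕ} (hm : Nat.card (H 0) < 2 ^ m) :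
    ∃ j < m, H j ≤ H (j + 1) := by
  by_contra! hne
  have hanti : Antitone H := antitone_nat_of_succ_le hH
  have hfin : ∀ j, Finite (H j) := fun j =>
    Finite.of_injective _ (Subgroup.inclusion_injective (hanti (Nat.zero_le j)))
  have hcard : ∀ j ≤ m, 2 ^ j * Nat.card (H j) ≤ Nat.card (H 0) := by
    intro j
    induction j with
    | zero => simp
    | succ j ih =>
      intro hj
      refine le_trans ?_ (ih (by omega))
      obtain ⟨c, hc⟩ := Subgroup.card_dvd_of_le (hH j)
      have := hfin j
      have hpos : 0 < Nat.card (H j) := Nat.card_pos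
      have hc2 : 2 ≤ c := by
        by_contra! hlt
        refine hne j (by omega) (Subgroup.eq_of_le_of_card_ge (hH j) ?_).ge
        rw [hc]
        nlinarith
      rw [hc, pow_succ]
      have : 2 * Nat.card (H (j + 1)) ≤ Nat.card (H (j + 1)) * c := by nlinarith
      calc 2 ^ j * 2 * Nat.card (H (j + 1)) = 2 ^ j * (2 * Nat.card (H (j + 1))) := by ring
        _ ≤ _ := Nat.mul_le_mul_left _ this
  have h1 := hcard m le_rfl
  have := hfin m
  have hpos : 0 < Nat.card (H m) := Nat.card_pos
  nlinarith [Nat.two_pow_pos m]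

/-- In positive dimension a full-dimensional cluster contains a second point `y`. If `R < r`, a
point of `X` within `R` of the midpoint of `x` and `y` would be closer than `2r` to both, hence
equal to both. The result ensures that `2R`-clusters contain the minimal-distance clusters. -/
theorem IsDelone.packing_le_covering {r R : ℝ} (h : IsDelone r R X) (hd : 1 ≤ d)
    {x : EuclideanSpace ℝ (Fin d)} (hx : x ∈ X) (hfull : IsFullDimensional (cluster X x (2 * r))) :
    r ≤ R := by
  have hr := h.packing.1.1
  obtain ⟨y, hy, hyx⟩ : ∃ y ∈ cluster X x (2 * r), y ≠ x := by
    by_contra! hall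
    have hsub : cluster X x (2 * r) ⊆ {x} := fun y hy => hall y hy
    have h1 : (⊤ : AffineSubspace ℝ (EuclideanSpace ℝ (Fin d))) ≤ affineSpan ℝ {x} := by
      rw [← (hfull : affineSpan ℝ _ = ⊤)]
      exact affineSpan_mono ℝ hsub
    have h2 : ∀ z : EuclideanSpace ℝ (Fin d), z = x := fun z => by
      simpa using h1 (AffineSubspace.mem_top ℝ _ z)
    have h3 := (h2 (EuclideanSpace.single ⟨0, hd⟩ 1)).trans (h2 0).symm
    simpa using congrArg norm h3
  by_contra! hlt
  obtain ⟨w, hwX, hw⟩ := h.covering.1.2 (midpoint ℝ x y)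
  have hxy : dist x y ≤ 2 * r := by rw [dist_comm]; exact hy.2
  have hmx : dist (midpoint ℝ x y) x ≤ r := by
    rw [dist_midpoint_left]
    norm_num
    linarith
  have hmy : dist (midpoint ℝ x y) y ≤ r := by
    rw [dist_midpoint_right]
    norm_num
    linarith
  rw [mem_closedBall] at hw
  have hwx : w = x := by
    by_contra hne
    linarith [h.two_mul_le_dist hwX hx hne, dist_triangle w (midpoint ℝ x y) x]
  have hwy : w = y := by
    by_contra hne
    linarith [h.two_mul_le_dist hwX hy.1 hne, dist_triangle w (midpoint ℝ x y) y]
  exact hyx (hwy.symm.trans hwx)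

theorem isFullDimensional_of_mem_minClusterFamily (hd : 1 ≤ d) {r R : ℝ}
    (hX : X ∈ minClusterFamily d r R) {x : EuclideanSpace ℝ (Fin d)} (hx : x ∈ X) :
    IsFullDimensional (cluster X x (2 * r)) := by
  obtain ⟨h, hiso, x₀, hx₀, hfull⟩ := hX
  have hrR := h.packing_le_covering hd hx₀ hfull
  obtain ⟨g, hg, hgc⟩ := hiso x₀ hx₀ x hx
  have hc := image_cluster_of_le (by linarith : 2 * r ≤ 2 * R) hg hgc
  have hspan := AffineMap.span_eq_top_of_surjective g.toRealAffineIsometryEquiv.toAffineMap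
    g.surjective hfull
  rwa [show ⇑g.toRealAffineIsometryEquiv.toAffineMap = ⇑g from rfl, hc] at hspan

theorem one_le_kissingNumber (hd : 1 ≤ d) :
    1 ≤ kissingNumber d := by
  have := _root_.card_le_kissingNumber (d := d) {EuclideanSpace.single ⟨0, hd⟩ 2} (by simp) (by simp)
  simpa using this

theorem isRegularSystem_of_mem_minClusterFamily (hd : 1 ≤ d) {r R : ℝ}
    (hX : X ∈ minClusterFamily d r R)
    (hiso : IsRadiusIsometric (2 * (d * Real.logb 2 (kissingNumber d) + 2) * R) X) :
    IsRegularSystem X := by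
  intro x hx
  obtain ⟨h, -, x₀, hx₀, hfull₀⟩ := id hX
  have hR := h.covering.1.1
  have hrR := h.packing_le_covering hd hx₀ hfull₀
  have hτ := one_le_kissingNumber hd
  have hτ' : (1 : ℝ) ≤ kissingNumber d := by exact_mod_cast hτ
  have hlog : 0 ≤ Real.logb 2 (kissingNumber d) := Real.logb_nonneg one_lt_two hτ'
  set L := (d : ℝ) * Real.logb 2 (kissingNumber d) with hL
  have hL0 : 0 ≤ L := by positivity
  have hmono : ∀ {i j : ℕ}, i ≤ j → 2 * ((i : ℝ) + 1) * R ≤ 2 * ((j : ℝ) + 1) * R := by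
    intro i j hij
    have : (i : ℝ) ≤ j := by exact_mod_cast hij
    nlinarith
  obtain ⟨hfin, hcard⟩ := h.card_clusterGroup_le hx
    (isFullDimensional_of_mem_minClusterFamily hd hX hx)
    (by push_cast; nlinarith : 2 * r ≤ 2 * (((0 : ℕ) : ℝ) + 1) * R)
  have hlt : Nat.card (clusterGroup X x (2 * (((0 : ℕ) : ℝ) + 1) * R)) < 2 ^ (⌊L⌋₊ + 1) := by
    refine hcard.trans_lt ?_
    have h1 : ((kissingNumber d : ℝ)) ^ d = 2 ^ L := by
      rw [hL, mul_comm, Real.rpow_mul two_pos.le, Real.rpow_logb two_pos (by norm_num)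
        (by linarith), Real.rpow_natCast]
    have h2 : (2 : ℝ) ^ L < 2 ^ (⌊L⌋₊ + 1) := by
      rw [← Real.rpow_natCast]
      refine Real.rpow_lt_rpow_of_exponent_lt one_lt_two ?_
      push_cast
      exact Nat.lt_floor_add_one L
    rw [← h1] at h2
    exact_mod_cast h2
  -- The chain starts at radius `2R` and grows by `2R`. Since `j ≤ ⌊L⌋`, the larger of the two radii
  -- with equal groups is `2(j + 2)R ≤ 2(L + 2)R`.
  obtain ⟨j, hj, hle⟩ := Subgroup.exists_eq_succ_of_card_lt
    (fun j : ℕ => clusterGroup X x (2 * ((j : ℝ) + 1) * R))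
    (fun j => clusterGroup_anti (hmono (Nat.le_succ j))) hlt
  have hρ : 2 * ((j : ℝ) + 1) * R + 2 * R ≤ 2 * (L + 2) * R := by
    have : (j : ℝ) ≤ L := le_trans (by exact_mod_cast Nat.lt_succ_iff.1 hj) (Nat.floor_le hL0)
    nlinarith
  have e : 2 * (((j + 1 : ℕ) : ℝ) + 1) * R = 2 * ((j : ℝ) + 1) * R + 2 * R := by
    push_cast
    ring
  have hiso' := hiso.mono hρ
  simp only [e] at hle
  refine h.isRegularSystem_of_clusterGroup_le (by positivity) hiso' ?_ x hx
  intro y hy g hg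
  obtain ⟨k, hk, hkc⟩ := hiso' x hx y hy
  have hkc' := image_cluster_of_le (by linarith : 2 * ((j : ℝ) + 1) * R ≤ _) hk hkc
  -- Conjugation by a cluster equivalence carries the group at `x` to the group at `y`, so stability
  -- found at one point holds at all.
  have hconj : ∀ ρ : ℝ, k '' cluster X x ρ = cluster X y ρ →
      (g ∈ clusterGroup X y ρ ↔ k⁻¹ * g * k ∈ clusterGroup X x ρ) := by
    intro ρ hρ
    have hki : ∀ z, k⁻¹ z = x ↔ z = y := fun z => by
      rw [← hk]
      constructor
      · intro e
        rw [← e, IsometryEquiv.apply_inv_self]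
      · rintro rfl
        exact IsometryEquiv.inv_apply_self k x
    rw [mem_clusterGroup, mem_clusterGroup, IsometryEquiv.coe_mul, IsometryEquiv.coe_mul,
      Set.image_comp, Set.image_comp, hρ, Function.comp_apply, Function.comp_apply, hk, hki]
    refine and_congr_right fun _ => ?_
    constructor
    · intro hgc
      rw [hgc, ← hρ, ← Set.image_comp]
      simp
    · intro hgc
      have := congrArg (k '' ·) hgc
      rw [hρ, ← Set.image_comp] at this
      simpa using this
  exact (hconj _ hkc).2 (hle ((hconj _ hkc').1 hg))

end Regularity

/-! ### The Fischer inner product on polynomials. -/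

section Fischer

open MvPolynomial

variable {n : ℕ}

/-- The Fischer (Bombieri) inner product of two real polynomials. -/
noncomputable def fischer (p q : MvPolynomial (Fin n) ℝ) : ℝ :=
  ∑ α ∈ p.support, (∏ i, ((α i).factorial : ℝ)) * coeff α p * coeff α q

theorem fischer_eq_sum {p : MvPolynomial (Fin n) ℝ} (q : MvPolynomial (Fin n) ℝ)
    {S : Finset (Fin n →₀ ℕ)} (hS : p.support ⊆ S) :
    fischer p q = ∑ α ∈ S, (∏ i, ((α i).factorial : ℝ)) * coeff α p * coeff α q := by
  refine Finset.sum_subset hS fun α _ hα => ?_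
  rw [notMem_support_iff.1 hα]
  ring

theorem fischer_add_left (p p' q : MvPolynomial (Fin n) ℝ) :
    fischer (p + p') q = fischer p q + fischer p' q := by
  classical
  rw [fischer_eq_sum (p := p + p') q support_add,
    fischer_eq_sum (p := p) q Finset.subset_union_left,
    fischer_eq_sum (p := p') q Finset.subset_union_right, ← Finset.sum_add_distrib]
  refine Finset.sum_congr rfl fun α _ => ?_
  rw [coeff_add]
  ring

theorem fischer_add_right (p q q' : MvPolynomial (Fin n) ℝ) :
    fischer p (q + q') = fischer p q + fischer p q' := by
  simp_rw [fischer, ← Finset.sum_add_distrib, coeff_add, mul_add]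

theorem fischer_C_mul_left (c : ℝ) (p q : MvPolynomial (Fin n) ℝ) :
    fischer (C c * p) q = c * fischer p q := by
  rw [fischer_eq_sum (p := C c * p) q (S := p.support), fischer, Finset.mul_sum]
  · refine Finset.sum_congr rfl fun α _ => ?_
    rw [coeff_C_mul]
    ring
  · intro α
    simp only [mem_support_iff, coeff_C_mul]
    exact right_ne_zero_of_mul

theorem fischer_C_mul_right (c : ℝ) (p q : MvPolynomial (Fin n) ℝ) :
    fischer p (C c * q) = c * fischer p q := by
  rw [fischer, fischer, Finset.mul_sum]
  refine Finset.sum_congr rfl fun α _ => ?_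
  rw [coeff_C_mul]
  ring

theorem fischer_zero_left (q : MvPolynomial (Fin n) ℝ) : fischer 0 q = 0 := by
  simp [fischer]

theorem fischer_zero_right (q : MvPolynomial (Fin n) ℝ) : fischer q 0 = 0 := by
  simp [fischer]

theorem fischer_sum_left {ι : Type*} (s : Finset ι) (p : ι → MvPolynomial (Fin n) ℝ)
    (q : MvPolynomial (Fin n) ℝ) : fischer (∑ i ∈ s, p i) q = ∑ i ∈ s, fischer (p i) q := by
  classical
  induction s using Finset.induction_on with
  | empty => simp [fischer_zero_left]
  | insert a s ha ih => rw [Finset.sum_insert ha, Finset.sum_insert ha, fischer_add_left, ih]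

theorem fischer_sum_right {ι : Type*} (s : Finset ι) (p : ι → MvPolynomial (Fin n) ℝ)
    (q : MvPolynomial (Fin n) ℝ) : fischer q (∑ i ∈ s, p i) = ∑ i ∈ s, fischer q (p i) := by
  classical
  induction s using Finset.induction_on with
  | empty => simp [fischer_zero_right]
  | insert a s ha ih => rw [Finset.sum_insert ha, Finset.sum_insert ha, fischer_add_right, ih]

theorem fischer_monomial (α : Fin n →₀ ℕ) (c : ℝ) (q : MvPolynomial (Fin n) ℝ) :
    fischer (monomial α c) q = (∏ i, ((α i).factorial : ℝ)) * c * coeff α q := by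
  rw [fischer_eq_sum q support_monomial_subset, Finset.sum_singleton, coeff_monomial, if_pos rfl]

/-- Multiplication by a variable is adjoint to partial differentiation. -/
theorem fischer_X_mul (i : Fin n) (p q : MvPolynomial (Fin n) ℝ) :
    fischer (X i * p) q = fischer p (pderiv i q) := by
  induction p using MvPolynomial.induction_on' with
  | monomial α c =>
    rw [X, monomial_mul, one_mul, fischer_monomial, fischer_monomial, coeff_pderiv, add_comm]
    have : (∏ j, (((α + Finsupp.single i 1 : Fin n →₀ ℕ) j).factorial : ℝ)) =
        ((α i : ℝ) + 1) * ∏ j, ((α j).factorial : ℝ) := by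
      rw [← Finset.mul_prod_erase _ _ (Finset.mem_univ i),
        ← Finset.mul_prod_erase _ _ (Finset.mem_univ i), ← mul_assoc]
      congr 1
      · simp [Nat.factorial_succ]
      · refine Finset.prod_congr rfl fun j hj => ?_
        simp [(Finset.ne_of_mem_erase hj).symm]
    rw [this]
    ring
  | add p p' hp hp' => rw [mul_add, fischer_add_left, hp, hp', fischer_add_left]

/-- The linear form with coefficients `y`. -/
noncomputable def linForm (y : Fin n → ℝ) : MvPolynomial (Fin n) ℝ := ∑ i, C (y i) * X i

/-- The sum of the squares of the variables. -/
noncomputable def sumSq (n : ℕ) : MvPolynomial (Fin n) ℝ := ∑ i, X i * X i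

/-- The derivative in the direction `y`. -/
noncomputable def dirDeriv (y : Fin n → ℝ) (p : MvPolynomial (Fin n) ℝ) :
    MvPolynomial (Fin n) ℝ := ∑ i, C (y i) * pderiv i p

/-- The Laplacian of a polynomial. -/
noncomputable def lapl (p : MvPolynomial (Fin n) ℝ) : MvPolynomial (Fin n) ℝ :=
  ∑ i, pderiv i (pderiv i p)

theorem fischer_linForm_mul (y : Fin n → ℝ) (p q : MvPolynomial (Fin n) ℝ) :
    fischer (linForm y * p) q = fischer p (dirDeriv y q) := by
  rw [linForm, dirDeriv, Finset.sum_mul, fischer_sum_left, fischer_sum_right]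
  refine Finset.sum_congr rfl fun i _ => ?_
  rw [mul_assoc, fischer_C_mul_left, fischer_C_mul_right, fischer_X_mul]

/-- Consequently harmonic polynomials are orthogonal to all multiples of `sumSq n`. -/
theorem fischer_sumSq_mul (p q : MvPolynomial (Fin n) ℝ) :
    fischer (sumSq n * p) q = fischer p (lapl q) := by
  rw [sumSq, lapl, Finset.sum_mul, fischer_sum_left, fischer_sum_right]
  refine Finset.sum_congr rfl fun i _ => ?_
  rw [mul_assoc, fischer_X_mul, fischer_X_mul]

theorem dirDeriv_mul (y : Fin n → ℝ) (p q : MvPolynomial (Fin n) ℝ) :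
    dirDeriv y (p * q) = dirDeriv y p * q + p * dirDeriv y q := by
  simp only [dirDeriv, Finset.sum_mul, Finset.mul_sum, ← Finset.sum_add_distrib, pderiv_mul]
  exact Finset.sum_congr rfl fun i _ => by ring

theorem dirDeriv_sub (y : Fin n → ℝ) (p q : MvPolynomial (Fin n) ℝ) :
    dirDeriv y (p - q) = dirDeriv y p - dirDeriv y q := by
  simp only [dirDeriv, ← Finset.sum_sub_distrib, map_sub, mul_sub]

theorem dirDeriv_C (y : Fin n → ℝ) (c : ℝ) : dirDeriv y (C c) = 0 := by
  simp [dirDeriv]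

theorem pderiv_linForm (y : Fin n → ℝ) (i : Fin n) : pderiv i (linForm y) = C (y i) := by
  classical
  simp [linForm, map_sum, pderiv_X, Pi.single_apply]

theorem pderiv_sumSq (i : Fin n) : pderiv i (sumSq n) = 2 * X i := by
  classical
  simp only [sumSq, map_sum, pderiv_mul, pderiv_X, Pi.single_apply]
  simp [Finset.sum_add_distrib, two_mul]

theorem dirDeriv_linForm (y : Fin n → ℝ) : dirDeriv y (linForm y) = C (∑ i, y i ^ 2) := by
  simp only [dirDeriv, pderiv_linForm, map_sum, ← C_mul, sq]

theorem dirDeriv_sumSq (y : Fin n → ℝ) : dirDeriv y (sumSq n) = 2 * linForm y := by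
  simp only [dirDeriv, pderiv_sumSq, linForm, Finset.mul_sum]
  exact Finset.sum_congr rfl fun i _ => by ring

theorem lapl_sub (p q : MvPolynomial (Fin n) ℝ) : lapl (p - q) = lapl p - lapl q := by
  simp only [lapl, ← Finset.sum_sub_distrib, map_sub]

theorem lapl_C_mul (c : ℝ) (p : MvPolynomial (Fin n) ℝ) : lapl (C c * p) = C c * lapl p := by
  simp only [lapl, Finset.mul_sum, pderiv_C_mul]

theorem lapl_linForm_mul (y : Fin n → ℝ) (p : MvPolynomial (Fin n) ℝ) :
    lapl (linForm y * p) = linForm y * lapl p + 2 * dirDeriv y p := by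
  simp only [lapl, dirDeriv, Finset.mul_sum, ← Finset.sum_add_distrib, pderiv_mul, map_add,
    pderiv_linForm, pderiv_C]
  exact Finset.sum_congr rfl fun i _ => by ring

/-- The cross term `4 ∑ xᵢ ∂ᵢ p` equals `4 k p` by Euler's identity. -/
theorem lapl_sumSq_mul {k : ℕ} {p : MvPolynomial (Fin n) ℝ} (hp : p.IsHomogeneous k) :
    lapl (sumSq n * p) = sumSq n * lapl p + C (4 * k + 2 * n : ℝ) * p := by
  have hE : ∑ i, X i * pderiv i p = C (k : ℝ) * p := by
    rw [hp.sum_X_mul_pderiv, nsmul_eq_mul]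
    simp
  have : ∀ i : Fin n, pderiv i (pderiv i (sumSq n * p)) =
      sumSq n * pderiv i (pderiv i p) + (4 * (X i * pderiv i p) + 2 * p) := by
    intro i
    have h2 : pderiv i (2 : MvPolynomial (Fin n) ℝ) = 0 := by
      rw [← map_ofNat C 2, pderiv_C]
    simp only [pderiv_mul, map_add, pderiv_sumSq, h2, pderiv_X_self]
    ring
  simp only [lapl, this, Finset.sum_add_distrib, ← Finset.mul_sum, hE, Finset.sum_const,
    Finset.card_univ, Fintype.card_fin, nsmul_eq_mul]
  simp only [map_add, map_mul, map_natCast, map_ofNat]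
  ring

theorem isHomogeneous_linForm (y : Fin n → ℝ) : (linForm y).IsHomogeneous 1 :=
  IsHomogeneous.sum _ _ _ fun i _ => isHomogeneous_C_mul_X _ i

theorem isHomogeneous_sumSq : (sumSq n).IsHomogeneous 2 :=
  IsHomogeneous.sum _ _ _ fun i _ => (isHomogeneous_X ℝ i).mul (isHomogeneous_X ℝ i)

theorem isHomogeneous_dirDeriv (y : Fin n → ℝ) {k : ℕ} {p : MvPolynomial (Fin n) ℝ}
    (hp : p.IsHomogeneous (k + 1)) : (dirDeriv y p).IsHomogeneous k :=
  IsHomogeneous.sum _ _ _ fun _ _ => hp.pderiv.C_mul _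

/-- Powers of linear forms reproduce evaluation of homogeneous polynomials. -/
theorem fischer_linForm_pow (y : Fin n → ℝ) (k : ℕ) {q : MvPolynomial (Fin n) ℝ}
    (hq : q.IsHomogeneous k) : fischer (linForm y ^ k) q = k.factorial * eval y q := by
  induction k generalizing q with
  | zero =>
    obtain ⟨c, rfl⟩ : ∃ c, q = C c :=
      ⟨_, totalDegree_eq_zero_iff_eq_C.1 ((totalDegree_zero_iff_isHomogeneous _).2 hq)⟩
    rw [pow_zero, show (1 : MvPolynomial (Fin n) ℝ) = monomial 0 1 from rfl, fischer_monomial]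
    simp
  | succ k ih =>
    rw [pow_succ', fischer_linForm_mul, ih (isHomogeneous_dirDeriv y hq), Nat.factorial_succ]
    -- Euler's identity at `y`: the derivative of `q` in the direction `y` takes the value `(k + 1)
    -- q(y)` there.
    have hE := congrArg (eval y) hq.sum_X_mul_pderiv
    have : eval y (dirDeriv y q) = ((k + 1 : ℕ) : ℝ) * eval y q := by
      simpa [dirDeriv, map_sum] using hE
    rw [this]
    push_cast
    ring

end Fischer

/-! ### Zonal harmonics and positive definiteness of Gegenbauer kernels. -/

/-- The recurrence coefficients of the monic Gegenbauer polynomials of the unit sphere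
of `ℝ^n`. -/
noncomputable def gegenbauerCoeff (n k : ℕ) : ℝ :=
  k * (k + n - 3) / ((2 * k + n - 2) * (2 * k + n - 4))

/-- The monic Gegenbauer polynomials of the unit sphere of `ℝ^n`. -/
noncomputable def gegenbauer (n : ℕ) : ℕ → ℝ → ℝ
  | 0, _ => 1
  | 1, t => t
  | k + 2, t => t * gegenbauer n (k + 1) t - gegenbauerCoeff n (k + 1) * gegenbauer n k t

section Zonal

open MvPolynomial

variable {n : ℕ}

/-- The homogeneous zonal polynomials: `|x|^k` times the Gegenbauer polynomial of `⟨x, y⟩ / |x|`,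
for a unit vector `y`. -/
noncomputable def zonal (y : Fin n → ℝ) : ℕ → MvPolynomial (Fin n) ℝ
  | 0 => 1
  | 1 => linForm y
  | k + 2 => linForm y * zonal y (k + 1) - C (gegenbauerCoeff n (k + 1)) * (sumSq n * zonal y k)

theorem isHomogeneous_zonal (y : Fin n → ℝ) (k : ℕ) : (zonal y k).IsHomogeneous k := by
  induction k using Nat.twoStepInduction with
  | zero => exact isHomogeneous_one _ _
  | one => exact isHomogeneous_linForm y
  | more k h0 h1 =>
    rw [zonal]
    refine IsHomogeneous.sub ?_ (IsHomogeneous.C_mul ?_ _)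
    · rw [show k + 2 = 1 + (k + 1) by ring]
      exact (isHomogeneous_linForm y).mul h1
    · rw [add_comm k 2]
      exact isHomogeneous_sumSq.mul h0

theorem eval_zonal {x y : Fin n → ℝ} (hx : ∑ i, x i ^ 2 = 1) (k : ℕ) :
    eval x (zonal y k) = gegenbauer n k (∑ i, y i * x i) := by
  have h1 : eval x (linForm y) = ∑ i, y i * x i := by simp [linForm]
  have h2 : eval x (sumSq n) = 1 := by simpa [sumSq, sq] using hx
  induction k using Nat.twoStepInduction with
  | zero => simp [zonal, gegenbauer]
  | one => rw [zonal, gegenbauer, h1]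
  | more k ih0 ih1 =>
    rw [zonal, gegenbauer, map_sub, map_mul, map_mul, map_mul, h1, h2, ih0, ih1, eval_C, one_mul]

theorem zonal_eq_pow_add (y : Fin n → ℝ) (k : ℕ) :
    ∃ W, zonal y k = linForm y ^ k + sumSq n * W := by
  induction k using Nat.twoStepInduction with
  | zero => exact ⟨0, by simp [zonal]⟩
  | one => exact ⟨0, by simp [zonal]⟩
  | more k _ ih1 =>
    obtain ⟨W, hW⟩ := ih1
    refine ⟨linForm y * W - C (gegenbauerCoeff n (k + 1)) * zonal y k, ?_⟩
    rw [zonal, hW]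
    ring

theorem dirDeriv_zonal (hn : 3 ≤ n) {y : Fin n → ℝ} (hy : ∑ i, y i ^ 2 = 1) (k : ℕ) :
    dirDeriv y (zonal y (k + 1)) =
      C (gegenbauerCoeff n (k + 1) * (2 * k + n)) * zonal y k := by
  have hn' : (3 : ℝ) ≤ n := by exact_mod_cast hn
  -- Differentiating the recurrence for `zonal y (k + 2)` produces `sumSq n * dirDeriv y (zonal y
  -- k)`; the second identity, carried along in the induction, removes it.
  suffices h : dirDeriv y (zonal y (k + 1)) =
      C (gegenbauerCoeff n (k + 1) * (2 * k + n)) * zonal y k ∧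
      sumSq n * dirDeriv y (zonal y k) =
        C (2 * k + n - 2 : ℝ) * (linForm y * zonal y k - zonal y (k + 1)) from h.1
  induction k with
  | zero =>
    constructor
    · have : gegenbauerCoeff n (0 + 1) * (2 * (0 : ℕ) + n) = 1 := by
        rw [gegenbauerCoeff]
        push_cast
        have h1 : (n : ℝ) ≠ 0 := by linarith
        have h2 : (n : ℝ) - 2 ≠ 0 := by linarith
        rw [mul_one, mul_zero, zero_add, one_mul, add_sub_cancel_left,
          show (1 + (n : ℝ) - 3) = n - 2 by ring, show (2 + (n : ℝ) - 4) = n - 2 by ring]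
        field_simp
      rw [this, zonal, zonal, dirDeriv_linForm, hy, mul_one]
    · rw [zonal, zonal, mul_one, sub_self, mul_zero, ← C_1, dirDeriv_C, mul_zero]
  | succ k ih =>
    obtain ⟨h1, h2⟩ := ih
    have hk : (0 : ℝ) ≤ k := k.cast_nonneg
    constructor
    · rw [zonal, dirDeriv_sub, dirDeriv_mul, dirDeriv_mul, dirDeriv_mul, dirDeriv_C,
        dirDeriv_sumSq, h2, h1, dirDeriv_linForm, hy]
      have key : gegenbauerCoeff n (k + 1 + 1) * (2 * ((k + 1 : ℕ) : ℝ) + n) =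
          1 + gegenbauerCoeff n (k + 1) * (2 * k + n - 2) := by
        rw [gegenbauerCoeff, gegenbauerCoeff]
        push_cast
        rw [show (2 * ((k : ℝ) + 1 + 1) + n - 2) = 2 * k + n + 2 by ring,
          show (2 * ((k : ℝ) + 1 + 1) + n - 4) = 2 * k + n by ring,
          show (2 * ((k : ℝ) + 1) + n - 2) = 2 * k + n by ring,
          show (2 * ((k : ℝ) + 1) + n - 4) = 2 * k + n - 2 by ring]
        obtain ⟨A, hA⟩ : ∃ A : ℝ, A = 2 * k + n - 2 := ⟨_, rfl⟩
        have hA0 : 0 < A := by linarith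
        rw [show (2 * (k : ℝ) + n + 2) = A + 4 by linarith,
          show (2 * (k : ℝ) + n) = A + 2 by linarith,
          show (2 * ((k : ℝ) + 1) + n) = A + 4 by linarith, add_sub_cancel_right,
          show ((k : ℝ) + 1 + 1 + n - 3) = A + 1 - k by linarith,
          show ((k : ℝ) + 1 + n - 3) = A - k by linarith]
        field_simp
        ring
      rw [key]
      simp only [map_add, map_mul, map_sub, map_one, map_ofNat]
      ring
    · rw [h1, zonal]
      push_cast
      simp only [map_add, map_mul, map_sub, map_one, map_ofNat]
      ring

/-- In the recurrence the term `2 * dirDeriv y (zonal y (k + 1))` from the linear form cancels the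
`4k + 2n` term from `sumSq n`; `gegenbauerCoeff` is the coefficient that makes this happen. -/
theorem lapl_zonal (hn : 3 ≤ n) {y : Fin n → ℝ} (hy : ∑ i, y i ^ 2 = 1) (k : ℕ) :
    lapl (zonal y k) = 0 := by
  induction k using Nat.twoStepInduction with
  | zero => simp [zonal, lapl]
  | one => simp [zonal, lapl, pderiv_linForm]
  | more k ih0 ih1 =>
    rw [zonal, lapl_sub, lapl_linForm_mul, lapl_C_mul, lapl_sumSq_mul (isHomogeneous_zonal y k),
      ih0, ih1, dirDeriv_zonal hn hy]
    simp only [map_add, map_mul, map_natCast, map_ofNat]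
    ring

/-- Modulo a multiple of `sumSq n`, which is orthogonal to the harmonic `zonal y k`, the polynomial
`zonal x k` is a power of a linear form, and that power reproduces evaluation at `x`. -/
theorem fischer_zonal (hn : 3 ≤ n) {x y : Fin n → ℝ} (hx : ∑ i, x i ^ 2 = 1)
    (hy : ∑ i, y i ^ 2 = 1) (k : ℕ) :
    fischer (zonal x k) (zonal y k) = k.factorial * gegenbauer n k (∑ i, x i * y i) := by
  obtain ⟨W, hW⟩ := zonal_eq_pow_add x k
  rw [hW, fischer_add_left, fischer_sumSq_mul, lapl_zonal hn hy, fischer_zero_right, add_zero,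
    fischer_linForm_pow x k (isHomogeneous_zonal y k), eval_zonal hx]
  simp_rw [mul_comm]

/-- The Gegenbauer kernel on the unit sphere is the Gram kernel of a feature map into a space whose
dimension is the number of monomials of degree `k`. -/
theorem exists_gegenbauer_eq_sum (hn : 3 ≤ n) (k : ℕ) :
    ∃ φ : EuclideanSpace ℝ (Fin n) → (Fin n →₀ ℕ) → ℝ, ∀ x y : EuclideanSpace ℝ (Fin n),
      ‖x‖ = 1 → ‖y‖ = 1 → gegenbauer n k (inner ℝ x y) =
        ∑ α ∈ Finset.finsuppAntidiag Finset.univ k, φ x α * φ y α := by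
  refine ⟨fun x α => √((∏ i, ((α i).factorial : ℝ)) / k.factorial) * coeff α (zonal x k),
    fun x y hx hy => ?_⟩
  have hsq : ∀ z : EuclideanSpace ℝ (Fin n), ‖z‖ = 1 → ∑ i, z i ^ 2 = 1 := fun z hz => by
    rw [← EuclideanSpace.real_norm_sq_eq, hz, one_pow]
  have hinner : inner ℝ x y = ∑ i, x i * y i := by
    rw [PiLp.inner_apply]
    exact Finset.sum_congr rfl fun i _ => by simp [mul_comm]
  have hsupp : (zonal x k).support ⊆ Finset.finsuppAntidiag Finset.univ k := by
    intro α hα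
    rw [Finset.mem_finsuppAntidiag]
    refine ⟨?_, Finset.subset_univ _⟩
    have := (isHomogeneous_zonal x k).degree_eq_sum_deg_support hα
    rw [this]
    exact (Finset.sum_subset (Finset.subset_univ _) fun i _ hi => by simpa using hi).symm
  have h := fischer_zonal hn (hsq x hx) (hsq y hy) k
  rw [fischer_eq_sum _ hsupp] at h
  have hk : (k.factorial : ℝ) ≠ 0 := by exact_mod_cast k.factorial_ne_zero
  rw [hinner, ← mul_right_inj' hk, ← h, Finset.mul_sum]
  refine Finset.sum_congr rfl fun α _ => ?_
  have hs := Real.mul_self_sqrt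
    (by positivity : 0 ≤ (∏ i, ((α i).factorial : ℝ)) / k.factorial)
  calc _ = k.factorial * ((∏ i, ((α i).factorial : ℝ)) / k.factorial) *
        coeff α (zonal x k) * coeff α (zonal y k) := by
        rw [mul_div_cancel₀ _ hk]
    _ = _ := by
        rw [← hs]
        ring

end Zonal

/-! ### Products of Gram kernels. -/

section GramKernels

variable {E ι κ : Type*}

/-- A quantitative Schur product theorem: the product kernel has the tensor product of the two
feature maps as its feature map. -/
theorem sum_gram_mul_gram (C : Finset E) (A : Finset ι) (B : Finset κ) (φ : E → ι → ℝ)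
    (ψ : E → κ → ℝ) :
    ∑ x ∈ C, ∑ y ∈ C, (∑ a ∈ A, φ x a * φ y a) * (∑ b ∈ B, ψ x b * ψ y b) =
      ∑ a ∈ A, ∑ b ∈ B, (∑ x ∈ C, φ x a * ψ x b) ^ 2 := by
  simp_rw [sq, Finset.sum_mul_sum]
  rw [Finset.sum_congr rfl fun x _ => Finset.sum_comm, Finset.sum_comm]
  refine Finset.sum_congr rfl fun a _ => ?_
  rw [Finset.sum_congr rfl fun x _ => Finset.sum_comm, Finset.sum_comm]
  refine Finset.sum_congr rfl fun b _ => Finset.sum_congr rfl fun x _ =>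
    Finset.sum_congr rfl fun y _ => by ring

/-- The inequality (trace)² ≤ rank · (Frobenius norm)² for a Gram matrix: keep the squares with
equal indices and apply Cauchy–Schwarz over `A`. -/
theorem sq_sum_gram_diag_le (C : Finset E) (A : Finset ι) (φ : E → ι → ℝ) :
    (∑ x ∈ C, ∑ a ∈ A, φ x a * φ x a) ^ 2 ≤
      A.card * ∑ x ∈ C, ∑ y ∈ C, (∑ a ∈ A, φ x a * φ y a) * (∑ a ∈ A, φ x a * φ y a) := by
  rw [sum_gram_mul_gram, Finset.sum_comm]
  refine (sq_sum_le_card_mul_sum_sq (s := A)).trans ?_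
  gcongr with a ha
  exact Finset.single_le_sum (f := fun b => (∑ x ∈ C, φ x a * φ x b) ^ 2)
    (fun b _ => sq_nonneg _) ha

end GramKernels

/-! ### The linear programming bound for spherical codes. -/

section LinearProgramming

variable {n : ℕ}

theorem mul_gegenbauer {k : ℕ} (hk : 1 ≤ k) (t : ℝ) :
    t * gegenbauer n k t =
      gegenbauer n (k + 1) t + gegenbauerCoeff n k * gegenbauer n (k - 1) t := by
  obtain ⟨k, rfl⟩ : ∃ l, k = l + 1 := ⟨k - 1, by omega⟩
  rw [gegenbauer, Nat.add_sub_cancel]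
  ring

theorem gegenbauer_succ_one (hn : 3 ≤ n) (k : ℕ) :
    gegenbauer n (k + 1) 1 = (k + n - 2) / (2 * k + n - 2) * gegenbauer n k 1 := by
  have hn' : (3 : ℝ) ≤ n := by exact_mod_cast hn
  induction k with
  | zero =>
    have : (n : ℝ) - 2 ≠ 0 := by linarith
    simp [gegenbauer, this]
  | succ k ih =>
    have hk : (0 : ℝ) ≤ k := k.cast_nonneg
    have e1 : (k + n - 2 : ℝ) ≠ 0 := by linarith
    have e2 : (2 * k + n - 2 : ℝ) ≠ 0 := by linarith
    have e3 : (2 * k + n : ℝ) ≠ 0 := by linarith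
    have h : gegenbauer n k 1 =
        (2 * k + n - 2) / (k + n - 2) * gegenbauer n (k + 1) 1 := by
      rw [ih, ← mul_assoc, div_mul_div_cancel₀ e1, div_self e2, one_mul]
    rw [gegenbauer, h, gegenbauerCoeff]
    push_cast
    rw [show (k + 1 + n - 3 : ℝ) = k + n - 2 by ring,
      show (2 * (k + 1) + n - 2 : ℝ) = 2 * k + n by ring,
      show (2 * (k + 1) + n - 4 : ℝ) = 2 * k + n - 2 by ring,
      show (k + 1 + n - 2 : ℝ) = (2 * k + n) - (k + 1) by ring]
    generalize (k + n - 2 : ℝ) = P at *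
    generalize (2 * k + n - 2 : ℝ) = Q at *
    generalize (2 * k + n : ℝ) = S at *
    field_simp

theorem gegenbauer_one_pos (hn : 3 ≤ n) (k : ℕ) : 0 < gegenbauer n k 1 := by
  have hn' : (3 : ℝ) ≤ n := by exact_mod_cast hn
  induction k with
  | zero => simp [gegenbauer]
  | succ k ih =>
    have hk : (0 : ℝ) ≤ k := k.cast_nonneg
    rw [gegenbauer_succ_one hn]
    exact mul_pos (div_pos (by linarith) (by linarith)) ih

theorem gegenbauer_one_antitone (hn : 3 ≤ n) : Antitone fun k => gegenbauer n k 1 := by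
  have hn' : (3 : ℝ) ≤ n := by exact_mod_cast hn
  refine antitone_nat_of_succ_le fun k => ?_
  have hk : (0 : ℝ) ≤ k := k.cast_nonneg
  rw [gegenbauer_succ_one hn]
  refine mul_le_of_le_one_left (gegenbauer_one_pos hn k).le ?_
  rw [div_le_one (by linarith)]
  linarith

theorem sum_gegenbauer_mul_nonneg (hn : 3 ≤ n) (C : Finset (EuclideanSpace ℝ (Fin n)))
    (hC : ∀ x ∈ C, ‖x‖ = 1) (i j : ℕ) :
    0 ≤ ∑ x ∈ C, ∑ y ∈ C,
      gegenbauer n i (inner ℝ x y) * gegenbauer n j (inner ℝ x y) := by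
  obtain ⟨φ, hφ⟩ := exists_gegenbauer_eq_sum hn i
  obtain ⟨ψ, hψ⟩ := exists_gegenbauer_eq_sum hn j
  rw [Finset.sum_congr rfl fun x hx => Finset.sum_congr rfl fun y hy => by
    rw [hφ x y (hC x hx) (hC y hy), hψ x y (hC x hx) (hC y hy)], sum_gram_mul_gram]
  positivity

theorem sq_card_mul_gegenbauer_one_le (hn : 3 ≤ n) (C : Finset (EuclideanSpace ℝ (Fin n)))
    (hC : ∀ x ∈ C, ‖x‖ = 1) (i : ℕ) :
    (C.card * gegenbauer n i 1) ^ 2 ≤ ((n + i - 1).choose i : ℝ) * ∑ x ∈ C, ∑ y ∈ C,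
      gegenbauer n i (inner ℝ x y) * gegenbauer n i (inner ℝ x y) := by
  obtain ⟨φ, hφ⟩ := exists_gegenbauer_eq_sum hn i
  have h := sq_sum_gram_diag_le C (Finset.finsuppAntidiag Finset.univ i) φ
  rw [Finset.card_finsuppAntidiag_nat_eq_choose, Finset.card_univ, Fintype.card_fin] at h
  have h1 : ∑ x ∈ C, ∑ a ∈ Finset.finsuppAntidiag Finset.univ i, φ x a * φ x a =
      C.card * gegenbauer n i 1 := by
    rw [Finset.sum_congr rfl fun x hx => by
      rw [← hφ x x (hC x hx) (hC x hx), real_inner_self_eq_norm_sq, hC x hx, one_pow],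
      Finset.sum_const, nsmul_eq_mul]
  rw [h1] at h
  refine h.trans_eq ?_
  congr 1
  refine Finset.sum_congr rfl fun x hx => Finset.sum_congr rfl fun y hy => ?_
  rw [hφ x y (hC x hx) (hC y hy)]

/-- Multiplication by `t - s` acts on Gegenbauer expansions supported in a window of degrees through
a Jacobi matrix. -/
theorem sub_mul_sum_gegenbauer {i₀ m : ℕ} (hi₀ : 1 ≤ i₀) (v : ℕ → ℝ) (hv0 : v 0 = 0)
    (hvm : ∀ j, m ≤ j → v j = 0) (s t : ℝ) :
    (t - s) * ∑ j ∈ Finset.range (m + 1), v j * gegenbauer n (i₀ + j) t =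
      ∑ j ∈ Finset.range (m + 1),
        (v (j - 1) + gegenbauerCoeff n (i₀ + j + 1) * v (j + 1) - s * v j) *
          gegenbauer n (i₀ + j) t := by
  -- The zeros of `v` at both ends let the degree shifts stay in the window; at `j = 0` truncated
  -- subtraction reads `v (0 - 1) = v 0 = 0`.
  have e1 : ∑ j ∈ Finset.range (m + 1), v j * gegenbauer n (i₀ + j + 1) t =
      ∑ j ∈ Finset.range (m + 1), v (j - 1) * gegenbauer n (i₀ + j) t := by
    rw [Finset.sum_range_succ, Finset.sum_range_succ', hvm m le_rfl]
    simp [hv0, add_assoc]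
  have e2 : ∑ j ∈ Finset.range (m + 1),
        v j * gegenbauerCoeff n (i₀ + j) * gegenbauer n (i₀ + j - 1) t =
      ∑ j ∈ Finset.range (m + 1),
        gegenbauerCoeff n (i₀ + j + 1) * v (j + 1) * gegenbauer n (i₀ + j) t := by
    rw [Finset.sum_range_succ', Finset.sum_range_succ, hvm (m + 1) (by omega), hv0]
    simp only [zero_mul, mul_zero, add_zero]
    refine Finset.sum_congr rfl fun j _ => ?_
    rw [← add_assoc, Nat.add_sub_cancel]
    ring
  calc _ = ∑ j ∈ Finset.range (m + 1), v j * (t * gegenbauer n (i₀ + j) t) -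
        ∑ j ∈ Finset.range (m + 1), s * v j * gegenbauer n (i₀ + j) t := by
        rw [sub_mul, Finset.mul_sum, Finset.mul_sum]
        congr 1 <;> exact Finset.sum_congr rfl fun j _ => by ring
    _ = ∑ j ∈ Finset.range (m + 1), v j * gegenbauer n (i₀ + j + 1) t +
        ∑ j ∈ Finset.range (m + 1),
          v j * gegenbauerCoeff n (i₀ + j) * gegenbauer n (i₀ + j - 1) t -
        ∑ j ∈ Finset.range (m + 1), s * v j * gegenbauer n (i₀ + j) t := by
        rw [← Finset.sum_add_distrib]
        congr 1
        refine Finset.sum_congr rfl fun j _ => ?_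
        rw [mul_gegenbauer (by omega : 1 ≤ i₀ + j)]
        ring
    _ = _ := by
        rw [e1, e2, ← Finset.sum_add_distrib, ← Finset.sum_sub_distrib]
        exact Finset.sum_congr rfl fun j _ => by ring

/-- The linear programming bound with a test function supported in a window of degrees. -/
theorem card_mul_le_of_inner_le (hn : 3 ≤ n) {i₀ m : ℕ} (hi₀ : 1 ≤ i₀) (hm : 1 ≤ m) {v : ℕ → ℝ}
    (hv0 : v 0 = 0) (hvm : ∀ j, m ≤ j → v j = 0) (hv : ∀ j, 0 ≤ v j) {s c : ℝ} (hs : s ≤ 1)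
    (hw : ∀ j ≤ m, 0 ≤ v (j - 1) + gegenbauerCoeff n (i₀ + j + 1) * v (j + 1) - s * v j)
    (hc : c ≤ gegenbauerCoeff n (i₀ + 1 + 1) * v 2 - s * v 1)
    (C : Finset (EuclideanSpace ℝ (Fin n))) (hC : ∀ x ∈ C, ‖x‖ = 1)
    (hCs : ∀ x ∈ C, ∀ y ∈ C, x ≠ y → inner ℝ x y ≤ s) :
    c * v 1 * C.card ≤ (1 - s) * (∑ j ∈ Finset.range (m + 1), v j) ^ 2 *
      ((n + i₀).choose (i₀ + 1) : ℝ) := by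
  rcases C.eq_empty_or_nonempty with rfl | hne
  · simp only [Finset.card_empty, Nat.cast_zero, mul_zero]
    have := sub_nonneg.2 hs
    positivity
  set w : ℕ → ℝ := fun j => v (j - 1) + gegenbauerCoeff n (i₀ + j + 1) * v (j + 1) - s * v j
  set F : ℝ → ℝ := fun t => ∑ j ∈ Finset.range (m + 1), v j * gegenbauer n (i₀ + j) t with hF
  set q := gegenbauer n (i₀ + 1) 1 with hq
  have hq0 : 0 < q := gegenbauer_one_pos hn _
  set V := ∑ j ∈ Finset.range (m + 1), v j with hV
  set D : ℝ := ((n + i₀).choose (i₀ + 1) : ℝ) with hD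
  have hD0 : 0 < D := by
    rw [hD]
    exact_mod_cast Nat.choose_pos (by omega)
  set S : ℕ → ℕ → ℝ := fun i j => ∑ x ∈ C, ∑ y ∈ C,
      gegenbauer n i (inner ℝ x y) * gegenbauer n j (inner ℝ x y) with hS
  -- The test function is `(t - s) F(t)²`. Leaving it as a product of two expansions avoids
  -- linearizing products of Gegenbauer polynomials: each product is itself a positive definite
  -- kernel.
  have hexp : ∑ x ∈ C, ∑ y ∈ C, (inner ℝ x y - s) * F (inner ℝ x y) * F (inner ℝ x y) =
      ∑ j ∈ Finset.range (m + 1), ∑ l ∈ Finset.range (m + 1),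
        w j * v l * S (i₀ + j) (i₀ + l) := by
    have : ∀ t, (t - s) * F t * F t = ∑ j ∈ Finset.range (m + 1), ∑ l ∈ Finset.range (m + 1),
        w j * v l * (gegenbauer n (i₀ + j) t * gegenbauer n (i₀ + l) t) := by
      intro t
      rw [hF]
      dsimp only
      rw [sub_mul_sum_gegenbauer hi₀ v hv0 hvm, Finset.sum_mul_sum]
      exact Finset.sum_congr rfl fun j _ => Finset.sum_congr rfl fun l _ => by ring
    simp_rw [this, hS, Finset.mul_sum]
    rw [Finset.sum_congr rfl fun x _ => Finset.sum_comm, Finset.sum_comm]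
    refine Finset.sum_congr rfl fun j _ => ?_
    rw [Finset.sum_congr rfl fun x _ => Finset.sum_comm, Finset.sum_comm]
  have hterm : ∀ j ∈ Finset.range (m + 1), ∀ l ∈ Finset.range (m + 1),
      0 ≤ w j * v l * S (i₀ + j) (i₀ + l) := fun j hj l _ =>
    mul_nonneg (mul_nonneg (hw j (Nat.lt_succ_iff.1 (Finset.mem_range.1 hj))) (hv l))
      (sum_gegenbauer_mul_nonneg hn C hC _ _)
  have h1mem : 1 ∈ Finset.range (m + 1) := Finset.mem_range.2 (by omega)
  -- All terms are nonnegative; only `j = l = 1` is kept, and the rank inequality `hrank` bounds it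
  -- below.
  have hlow : c * v 1 * S (i₀ + 1) (i₀ + 1) ≤
      ∑ x ∈ C, ∑ y ∈ C, (inner ℝ x y - s) * F (inner ℝ x y) * F (inner ℝ x y) := by
    rw [hexp]
    refine le_trans ?_ (Finset.single_le_sum (f := fun j => ∑ l ∈ Finset.range (m + 1),
      w j * v l * S (i₀ + j) (i₀ + l)) (fun j hj => Finset.sum_nonneg (hterm j hj)) h1mem)
    refine le_trans ?_ (Finset.single_le_sum (f := fun l => w 1 * v l * S (i₀ + 1) (i₀ + l))
      (hterm 1 h1mem) h1mem)
    refine mul_le_mul_of_nonneg_right (mul_le_mul_of_nonneg_right ?_ (hv 1))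
      (sum_gegenbauer_mul_nonneg hn C hC _ _)
    simpa [w, hv0] using hc
  have hF1 : 0 ≤ F 1 := Finset.sum_nonneg fun j _ =>
    mul_nonneg (hv j) (gegenbauer_one_pos hn _).le
  have hF1' : F 1 ≤ V * q := by
    rw [hF, hV, Finset.sum_mul]
    refine Finset.sum_le_sum fun j _ => ?_
    rcases Nat.eq_zero_or_pos j with rfl | hj
    · simp [hv0]
    · exact mul_le_mul_of_nonneg_left (gegenbauer_one_antitone hn (by omega)) (hv j)
  -- Off the diagonal the test function is nonpositive, so only the `C.card` diagonal values `(1 -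
  -- s) F(1)²` matter.
  have hup : ∑ x ∈ C, ∑ y ∈ C, (inner ℝ x y - s) * F (inner ℝ x y) * F (inner ℝ x y) ≤
      C.card * ((1 - s) * (V * q) ^ 2) := by
    rw [← nsmul_eq_mul, ← Finset.sum_const]
    refine Finset.sum_le_sum fun x hx => ?_
    rw [← Finset.add_sum_erase _ _ hx]
    have hoff : ∑ y ∈ C.erase x, (inner ℝ x y - s) * F (inner ℝ x y) * F (inner ℝ x y) ≤ 0 := by
      refine Finset.sum_nonpos fun y hy => ?_
      rw [mul_assoc]
      exact mul_nonpos_of_nonpos_of_nonneg (sub_nonpos.2 (hCs x hx y (Finset.mem_of_mem_erase hy)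
        (Finset.ne_of_mem_erase hy).symm)) (mul_self_nonneg _)
    have hxx : inner ℝ x x = (1 : ℝ) := by
      rw [real_inner_self_eq_norm_sq, hC x hx, one_pow]
    rw [hxx, mul_assoc, ← sq]
    have : F 1 ^ 2 ≤ (V * q) ^ 2 := pow_le_pow_left₀ hF1 hF1' 2
    nlinarith [sub_nonneg.2 hs]
  have hrank := sq_card_mul_gegenbauer_one_le hn C hC (i₀ + 1)
  rw [show n + (i₀ + 1) - 1 = n + i₀ by omega] at hrank
  change (C.card * q) ^ 2 ≤ D * S (i₀ + 1) (i₀ + 1) at hrank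
  rcases le_or_gt (c * v 1) 0 with hneg | hpos
  · have h1 : c * v 1 * C.card ≤ 0 := mul_nonpos_of_nonpos_of_nonneg hneg (Nat.cast_nonneg _)
    have := sub_nonneg.2 hs
    exact h1.trans (by positivity)
  have hM : (0 : ℝ) < C.card := by exact_mod_cast hne.card_pos
  have hfin : c * v 1 * (C.card * q) ^ 2 ≤ D * (C.card * ((1 - s) * (V * q) ^ 2)) := by
    calc c * v 1 * (C.card * q) ^ 2 ≤ c * v 1 * (D * S (i₀ + 1) (i₀ + 1)) :=
          mul_le_mul_of_nonneg_left hrank hpos.le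
      _ = D * (c * v 1 * S (i₀ + 1) (i₀ + 1)) := by ring
      _ ≤ _ := mul_le_mul_of_nonneg_left (hlow.trans hup) hD0.le
  have hpos' : 0 < C.card * q ^ 2 := by positivity
  refine le_of_mul_le_mul_right ?_ hpos'
  calc _ = c * v 1 * (C.card * q) ^ 2 := by ring
    _ ≤ _ := hfin
    _ = _ := by ring

/-- Spherical codes with inner products at most `s < 2g`, where `g ^ 2` bounds the recurrence
coefficients from degree `i₀` on, have size at most a constant times the dimension of the space of
homogeneous polynomials of degree `i₀ + 1`. -/
theorem exists_card_le_mul_choose {s g : ℝ} (hg : 0 < g) (hs1 : s ≤ 1)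
    (hsg : s < 2 * g) :
    ∃ K : ℝ, 0 < K ∧ ∀ n i₀ : ℕ, 3 ≤ n → 1 ≤ i₀ → (∀ i ≥ i₀, g ^ 2 ≤ gegenbauerCoeff n i) →
      ∀ C : Finset (EuclideanSpace ℝ (Fin n)), (∀ x ∈ C, ‖x‖ = 1) →
        (∀ x ∈ C, ∀ y ∈ C, x ≠ y → inner ℝ x y ≤ s) →
        (C.card : ℝ) ≤ K * ((n + i₀).choose (i₀ + 1) : ℝ) := by
  obtain ⟨m, hm⟩ := exists_nat_gt (2 * g / (2 * g - s) + 2)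
  have hδ : 0 < 2 * g - s := by linarith
  have hmpos : 0 < 2 * g / (2 * g - s) := by positivity
  have hm' : 2 * g < (2 * g - s) * (m - 1) := by
    have : 2 * g / (2 * g - s) < m - 1 := by linarith
    rw [div_lt_iff₀ hδ] at this
    linarith
  have hm2 : 2 < m := by
    have : (2 : ℝ) < m := by linarith
    exact_mod_cast this
  -- The factor `g⁻¹ ^ j` symmetrizes the Jacobi matrix with constant coefficient `g ^ 2`. The
  -- parabola satisfies `u (j - 1) + u (j + 1) = 2 u j - 2` and `u j ≥ m - 1` inside the window, so
  -- the new coefficients are positive once `(2g - s)(m - 1) > 2g`; `m` depends on `s` and `g` only.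
  set u : ℕ → ℝ := fun j => (j : ℝ) * ((m - j : ℕ) : ℝ) with hu
  set v : ℕ → ℝ := fun j => u j * g⁻¹ ^ j with hv
  have hu0 : ∀ j, 0 ≤ u j := fun j => by positivity
  have hv0 : ∀ j, 0 ≤ v j := fun j => by have := hu0 j; positivity
  have hue : ∀ j ≤ m, u j = j * (m - j) := fun j hj => by rw [hu]; simp [Nat.cast_sub hj]
  have hcoef : ∀ (b : ℝ), g ^ 2 ≤ b → ∀ j, 1 ≤ j → j < m →
      g⁻¹ ^ j * ((2 * g - s) * (m - 1) - 2 * g) ≤ v (j - 1) + b * v (j + 1) - s * v j := by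
    intro b hb j hj hjm
    obtain ⟨j, rfl⟩ : ∃ l, j = l + 1 := ⟨j - 1, by omega⟩
    have hjm' : (j : ℝ) + 1 + 1 ≤ m := by exact_mod_cast hjm
    have hj0 : (0 : ℝ) ≤ j := j.cast_nonneg
    have h1 : v (j + 1 - 1) = g⁻¹ ^ (j + 1) * (g * u j) := by
      simp only [hv, Nat.add_sub_cancel, pow_succ]
      field_simp
    have h2 : g⁻¹ ^ (j + 1) * (g * u (j + 1 + 1)) ≤ b * v (j + 1 + 1) := by
      calc _ = g ^ 2 * v (j + 1 + 1) := by
            simp only [hv, pow_succ]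
            field_simp
        _ ≤ _ := mul_le_mul_of_nonneg_right hb (hv0 _)
    have h3 : g⁻¹ ^ (j + 1) * (g * u j) + g⁻¹ ^ (j + 1) * (g * u (j + 1 + 1)) -
        s * v (j + 1) = g⁻¹ ^ (j + 1) * (g * (u j + u (j + 1 + 1)) - s * u (j + 1)) := by
      simp only [hv]
      ring
    have h4 : (2 * g - s) * (m - 1) - 2 * g ≤ g * (u j + u (j + 1 + 1)) - s * u (j + 1) := by
      rw [hue j (by omega), hue (j + 1) (by omega), hue (j + 1 + 1) (by omega)]
      push_cast
      have : (m : ℝ) - 1 ≤ (j + 1) * (m - (j + 1)) := by nlinarith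
      nlinarith
    have := mul_le_mul_of_nonneg_left h4 (by positivity : 0 ≤ g⁻¹ ^ (j + 1))
    rw [h1]
    linarith
  set c := g⁻¹ * ((2 * g - s) * (m - 1) - 2 * g) with hc
  have hc0 : 0 < c := mul_pos (by positivity) (by linarith)
  have hv1 : 0 < v 1 := by
    have : 0 < u 1 := by
      rw [hue 1 (by omega)]
      have : (2 : ℝ) < m := by exact_mod_cast hm2
      push_cast
      linarith
    positivity
  have hvz : v 0 = 0 := by simp [hv, hu]
  -- The `+ 1` keeps the constant positive when `s = 1`.
  refine ⟨((1 - s) * (∑ j ∈ Finset.range (m + 1), v j) ^ 2 + 1) / (c * v 1), ?_, ?_⟩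
  · have := sub_nonneg.2 hs1
    positivity
  intro n i₀ hn hi₀ hb C hC hCs
  have hmain := card_mul_le_of_inner_le hn hi₀ (by omega : 1 ≤ m) (v := v) (c := c) hvz
    (fun j hj => by simp [hv, hu, Nat.sub_eq_zero_of_le hj]) hv0 hs1 (fun j hj => by
      rcases Nat.eq_zero_or_pos j with rfl | hj1
      · rw [Nat.zero_sub, hvz, mul_zero, sub_zero, zero_add]
        exact mul_nonneg ((sq_nonneg g).trans (hb _ (by omega))) (hv0 _)
      rcases hj.lt_or_eq with hjm | rfl
      · exact le_trans (mul_nonneg (by positivity) (by linarith))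
          (hcoef _ (hb _ (by omega)) j hj1 hjm)
      · have : v j = 0 := by simp [hv, hu]
        rw [this, mul_zero, sub_zero]
        exact add_nonneg (hv0 _)
          (mul_nonneg ((sq_nonneg g).trans (hb _ (by omega))) (hv0 _)))
    (by
      have := hcoef _ (hb (i₀ + 1 + 1) (by omega)) 1 le_rfl (by omega)
      rwa [pow_one, Nat.sub_self, hvz, zero_add] at this) C hC hCs
  rw [div_mul_eq_mul_div, le_div_iff₀ (by positivity)]
  have hch : (0 : ℝ) ≤ ((n + i₀).choose (i₀ + 1) : ℝ) := Nat.cast_nonneg _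
  linarith

end LinearProgramming

/-! ### Averaging over cylinders: from angle 60° to larger angles. -/

section Slabs

open MeasureTheory

variable {n : ℕ}

/-- The cylinder with axis `x`, radius `h` and axial coordinate in `[a, a + η]`. -/
def slab (a η h : ℝ) (x : EuclideanSpace ℝ (Fin n)) : Set (EuclideanSpace ℝ (Fin n)) :=
  {c | a ≤ inner ℝ x c ∧ inner ℝ x c ≤ a + η ∧ ‖c‖ ^ 2 - inner ℝ x c ^ 2 ≤ h ^ 2}

theorem measurableSet_slab (a η h : ℝ) (x : EuclideanSpace ℝ (Fin n)) :
    MeasurableSet (slab a η h x) := by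
  have hi : Continuous fun c : EuclideanSpace ℝ (Fin n) => (inner ℝ x c : ℝ) := by fun_prop
  have h1 := isClosed_le (continuous_const (y := a)) hi
  have h2 := isClosed_le hi (continuous_const (y := a + η))
  have h3 := isClosed_le ((continuous_norm.pow 2).sub (hi.pow 2)) (continuous_const (y := h ^ 2))
  exact (h1.inter (h2.inter h3)).measurableSet

theorem slab_subset_closedBall {a η h ρ : ℝ} (ha : 0 ≤ a) (hρ : 0 ≤ ρ)
    (hρa : (a + η) ^ 2 + h ^ 2 ≤ ρ ^ 2) (x : EuclideanSpace ℝ (Fin n)) :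
    slab a η h x ⊆ closedBall 0 ρ := by
  rintro c ⟨h1, h2, h3⟩
  rw [mem_closedBall, dist_zero_right]
  refine abs_le_of_sq_le_sq' ?_ hρ |>.2
  nlinarith

/-- A ball is covered by a number of translates of the thin cylinder that does not depend on the
dimension. -/
theorem volume_ball_le_slab {a η h : ℝ} (hη : 0 < η) {N : ℕ} (hN : 2 * h ≤ N * η)
    {x : EuclideanSpace ℝ (Fin n)} (hx : ‖x‖ = 1) :
    volume (ball (0 : EuclideanSpace ℝ (Fin n)) h) ≤ N * volume (slab a η h x) := by
  -- The ball is cut into layers of thickness `η` orthogonal to `x`; the `k`-th translation moves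
  -- the axial interval starting at `-h + kη` to `[a, a + η]`.
  have hsub : ball (0 : EuclideanSpace ℝ (Fin n)) h ⊆ ⋃ k ∈ Finset.range N,
      (fun z => z + (a + h - k * η) • x) ⁻¹' slab a η h x := by
    intro z hz
    rw [mem_ball, dist_zero_right] at hz
    have habs : |inner ℝ x z| < h := by
      have := abs_real_inner_le_norm x z
      rw [hx, one_mul] at this
      exact this.trans_lt hz
    obtain ⟨hl, hr⟩ := abs_lt.1 habs
    set t : ℝ := inner ℝ x z with ht
    have hq : 0 ≤ (t + h) / η := div_nonneg (by linarith) hη.le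
    have hf1 := Nat.floor_le hq
    have hf2 := Nat.lt_floor_add_one ((t + h) / η)
    rw [le_div_iff₀ hη] at hf1
    rw [div_lt_iff₀ hη] at hf2
    have hfN : ⌊(t + h) / η⌋₊ < N := by
      rw [Nat.floor_lt hq, div_lt_iff₀ hη]
      linarith
    refine Set.mem_biUnion (Finset.mem_range.2 hfN) ?_
    set k := ⌊(t + h) / η⌋₊
    set l := a + h - k * η with hl
    have hin : inner ℝ x (z + l • x) = t + l := by
      rw [inner_add_right, inner_smul_right, real_inner_self_eq_norm_sq, hx]
      ring
    have hno : ‖z + l • x‖ ^ 2 = ‖z‖ ^ 2 + 2 * l * t + l ^ 2 := by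
      rw [norm_add_sq_real, inner_smul_right, norm_smul, hx, mul_one, real_inner_comm, ← ht,
        Real.norm_eq_abs, sq_abs]
      ring
    refine ⟨?_, ?_, ?_⟩
    · rw [hin]
      linarith
    · rw [hin]
      linarith
    · rw [hin, hno]
      nlinarith [norm_nonneg z, sq_nonneg t]
  refine (measure_mono hsub).trans ((measure_biUnion_finset_le _ _).trans ?_)
  simp only [measure_preimage_add_right, Finset.sum_const, Finset.card_range, nsmul_eq_mul]
  exact le_rfl

/-- Points of norm at most `√Q ≤ 1` at mutual distance at least `1` are seen from the origin under
an angle of cosine at most `1 - 1 / (2 Q)`. -/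
theorem inner_le_of_one_le_norm_sub {E : Type*} [NormedAddCommGroup E] [InnerProductSpace ℝ E]
    {Q : ℝ} (hQ0 : 0 < Q) (hQ1 : Q ≤ 1) {p q : E} (hp : ‖p‖ ^ 2 ≤ Q) (hq : ‖q‖ ^ 2 ≤ Q)
    (hpq : 1 ≤ ‖p - q‖) : inner ℝ p q ≤ (1 - 1 / (2 * Q)) * (‖p‖ * ‖q‖) := by
  -- Expanding `‖p - q‖² ≥ 1` reduces the claim to this inequality between norms, which follows from
  -- `Q(A² - AB) + AB = QA² + (1 - Q)AB ≤ A² ≤ Q`.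
  have key : ∀ A B : ℝ, 0 ≤ B → B ≤ A → A ^ 2 ≤ Q → Q * (A - B) ^ 2 + A * B ≤ Q := by
    intro A B hB hBA hA
    have h1 : (A - B) ^ 2 ≤ A ^ 2 - A * B := by nlinarith
    have h2 : A * B ≤ A ^ 2 := by nlinarith
    nlinarith [mul_le_mul_of_nonneg_left h1 hQ0.le, mul_le_mul_of_nonneg_left h2 (sub_nonneg.2 hQ1)]
  have hkey : Q * (‖p‖ - ‖q‖) ^ 2 + ‖p‖ * ‖q‖ ≤ Q := by
    rcases le_total ‖q‖ ‖p‖ with h | h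
    · exact key _ _ (norm_nonneg _) h hp
    · have := key _ _ (norm_nonneg _) h hq
      linarith [mul_comm ‖p‖ ‖q‖, congrArg (Q * ·) (sub_sq_comm ‖p‖ ‖q‖)]
  have h1 : 1 ≤ ‖p - q‖ ^ 2 := one_le_pow₀ hpq
  rw [norm_sub_sq_real] at h1
  have h2 : (1 - 1 / (2 * Q)) * (‖p‖ * ‖q‖) =
      (2 * Q * (‖p‖ * ‖q‖) - ‖p‖ * ‖q‖) / (2 * Q) := by
    field_simp
  rw [h2, le_div_iff₀ (by positivity)]
  nlinarith [mul_le_mul_of_nonneg_left h1 hQ0.le]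

/-- The points of a spherical code whose cylinders contain a given point project from that point to
a spherical code with a larger minimal angle. -/
theorem card_filter_mem_slab_le {a η h Q s A : ℝ} (hη : a + η < 1) (hQ : (1 - a) ^ 2 + h ^ 2 ≤ Q)
    (hQ1 : Q ≤ 1) (hs : 1 - 1 / (2 * Q) ≤ s) (hs1 : s < 1)
    (hA : ∀ C : Finset (EuclideanSpace ℝ (Fin n)), (∀ x ∈ C, ‖x‖ = 1) →
      (∀ x ∈ C, ∀ y ∈ C, x ≠ y → inner ℝ x y ≤ s) → (C.card : ℝ) ≤ A)
    (T : Finset (EuclideanSpace ℝ (Fin n))) (hT : ∀ x ∈ T, ‖x‖ = 1)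
    (hTd : ∀ x ∈ T, ∀ y ∈ T, x ≠ y → 1 ≤ dist x y) (c : EuclideanSpace ℝ (Fin n))
    [DecidablePred fun x => c ∈ slab a η h x] :
    ((T.filter fun x => c ∈ slab a η h x).card : ℝ) ≤ A := by
  classical
  set S := T.filter fun x => c ∈ slab a η h x with hS
  -- Pythagoras along the axis: `‖x - c‖²` is `(1 - ⟨x, c⟩)²` plus the squared distance from `c` to
  -- the axis, at most `(1 - a)² + h²`.
  have hmem : ∀ x ∈ S, x - c ≠ 0 ∧ ‖x - c‖ ^ 2 ≤ Q := by
    intro x hx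
    obtain ⟨hxT, h1, h2, h3⟩ := Finset.mem_filter.1 hx
    constructor
    · intro h0
      rw [← sub_eq_zero.1 h0, real_inner_self_eq_norm_sq, hT x hxT] at h2
      linarith
    · rw [norm_sub_sq_real, hT x hxT]
      nlinarith
  set f : EuclideanSpace ℝ (Fin n) → EuclideanSpace ℝ (Fin n) :=
    fun x => ‖x - c‖⁻¹ • (x - c) with hf
  have hfn : ∀ x ∈ S, ‖f x‖ = 1 := fun x hx => norm_smul_inv_norm (𝕜 := ℝ) (hmem x hx).1
  have hfi : ∀ x ∈ S, ∀ y ∈ S, x ≠ y → inner ℝ (f x) (f y) ≤ s := by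
    intro x hx y hy hxy
    have hQ0 : 0 < Q := lt_of_lt_of_le (pow_pos (norm_pos_iff.2 (hmem x hx).1) 2) (hmem x hx).2
    have h1 := inner_le_of_one_le_norm_sub hQ0 hQ1 (hmem x hx).2 (hmem y hy).2 (by
      rw [sub_sub_sub_cancel_right, ← dist_eq_norm]
      exact hTd x (Finset.mem_filter.1 hx).1 y (Finset.mem_filter.1 hy).1 hxy)
    have hp := norm_pos_iff.2 (hmem x hx).1
    have hq := norm_pos_iff.2 (hmem y hy).1
    rw [hf]
    dsimp only
    rw [real_inner_smul_left, real_inner_smul_right, ← mul_assoc, ← mul_inv, inv_mul_eq_div,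
      div_le_iff₀ (mul_pos hp hq)]
    exact h1.trans (mul_le_mul_of_nonneg_right hs (mul_pos hp hq).le)
  have hinj : Set.InjOn f S := by
    intro x hx y hy hxy
    by_contra hne
    have := hfi x hx y hy hne
    rw [hxy, real_inner_self_eq_norm_sq, hfn y hy] at this
    linarith
  rw [← Finset.card_image_of_injOn hinj]
  refine hA _ ?_ ?_
  · simp only [Finset.mem_image]
    rintro _ ⟨x, hx, rfl⟩
    exact hfn x hx
  · simp only [Finset.mem_image]
    rintro _ ⟨x, hx, rfl⟩ _ ⟨y, hy, rfl⟩ hne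
    exact hfi x hx y hy fun e => hne (by rw [e])

/-- Averaging over cylinders bounds the size of a spherical code of minimal angle `60°` by the size
of codes with a larger minimal angle. -/
theorem card_mul_pow_le_of_one_le_dist {a η h ρ Q s A : ℝ} (ha : 0 ≤ a) (hη0 : 0 < η) (hh : 0 ≤ h)
    (hρ : 0 ≤ ρ) (hρa : (a + η) ^ 2 + h ^ 2 ≤ ρ ^ 2) (hη : a + η < 1)
    (hQ : (1 - a) ^ 2 + h ^ 2 ≤ Q) (hQ1 : Q ≤ 1) (hs : 1 - 1 / (2 * Q) ≤ s) (hs1 : s < 1)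
    {N : ℕ} (hN : 2 * h ≤ N * η)
    (hA : ∀ C : Finset (EuclideanSpace ℝ (Fin n)), (∀ x ∈ C, ‖x‖ = 1) →
      (∀ x ∈ C, ∀ y ∈ C, x ≠ y → inner ℝ x y ≤ s) → (C.card : ℝ) ≤ A)
    (T : Finset (EuclideanSpace ℝ (Fin n))) (hT : ∀ x ∈ T, ‖x‖ = 1)
    (hTd : ∀ x ∈ T, ∀ y ∈ T, x ≠ y → 1 ≤ dist x y) :
    T.card * h ^ n ≤ N * A * ρ ^ n := by
  classical
  have hA0 : 0 ≤ A := by simpa using hA ∅ (by simp) (by simp)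
  -- Double counting: a point lies in at most `A` cylinders, and in none outside the ball of radius
  -- `ρ`.
  have hsum : ∑ x ∈ T, volume (slab a η h x) ≤
      ENNReal.ofReal A * volume (closedBall (0 : EuclideanSpace ℝ (Fin n)) ρ) := by
    have h1 : ∀ x ∈ T, volume (slab a η h x) = ∫⁻ c, (slab a η h x).indicator 1 c := fun x _ =>
      (lintegral_indicator_one (measurableSet_slab a η h x)).symm
    rw [Finset.sum_congr rfl h1, ← lintegral_finsetSum _ fun x _ =>
      measurable_one.indicator (measurableSet_slab a η h x),
      ← lintegral_indicator_const measurableSet_closedBall]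
    refine lintegral_mono fun c => ?_
    have hcount : ∑ x ∈ T, (slab a η h x).indicator (1 : EuclideanSpace ℝ (Fin n) → ENNReal) c =
        ((T.filter fun x => c ∈ slab a η h x).card : ENNReal) := by
      simp [Set.indicator_apply]
    dsimp only
    rw [hcount]
    by_cases hc : c ∈ closedBall (0 : EuclideanSpace ℝ (Fin n)) ρ
    · rw [Set.indicator_of_mem hc, ← ENNReal.ofReal_natCast]
      exact ENNReal.ofReal_le_ofReal (card_filter_mem_slab_le hη hQ hQ1 hs hs1 hA T hT hTd c)
    · rw [Finset.filter_false_of_mem fun x _ hx => hc (slab_subset_closedBall ha hρ hρa x hx)]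
      simp
  have hball : T.card * volume (ball (0 : EuclideanSpace ℝ (Fin n)) h) ≤
      N * (ENNReal.ofReal A * volume (closedBall (0 : EuclideanSpace ℝ (Fin n)) ρ)) := by
    calc _ = ∑ x ∈ T, volume (ball (0 : EuclideanSpace ℝ (Fin n)) h) := by
          rw [Finset.sum_const, nsmul_eq_mul]
      _ ≤ ∑ x ∈ T, N * volume (slab a η h x) :=
          Finset.sum_le_sum fun x hx => volume_ball_le_slab hη0 hN (hT x hx)
      _ = N * ∑ x ∈ T, volume (slab a η h x) := by rw [Finset.mul_sum]
      _ ≤ _ := by gcongr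
  set V := volume (ball (0 : EuclideanSpace ℝ (Fin n)) 1) with hV
  have hV0 : V ≠ 0 := (measure_ball_pos _ _ one_pos).ne'
  have hVt : V ≠ ⊤ := measure_ball_lt_top.ne
  rcases Nat.eq_zero_or_pos n with rfl | hn
  · have hT1 : T.card ≤ 0 := by
      refine Finset.card_eq_zero.2 (Finset.eq_empty_of_forall_notMem fun x hx => ?_) |>.le
      have := hT x hx
      rw [Subsingleton.elim x 0, norm_zero] at this
      exact zero_ne_one this
    rw [Nat.le_zero.1 hT1]
    simp only [Nat.cast_zero, zero_mul]
    positivity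
  have : Nonempty (Fin n) := ⟨⟨0, hn⟩⟩
  rw [Measure.addHaar_ball _ _ hh, Measure.addHaar_closedBall _ _ hρ, finrank_euclideanSpace_fin,
    ← hV, ← mul_assoc, ← mul_assoc, ← mul_assoc, ENNReal.mul_le_mul_iff_left hV0 hVt,
    ← ENNReal.ofReal_natCast, ← ENNReal.ofReal_natCast, ← ENNReal.ofReal_mul (by positivity),
    ← ENNReal.ofReal_mul (by positivity), ← ENNReal.ofReal_mul (by positivity)] at hball
  exact (ENNReal.ofReal_le_ofReal_iff (by positivity)).1 hball

end Slabs

/-! ### The exponential bound for the kissing number. -/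

section KissingNumber

variable {n : ℕ}

/-- The kissing number is the size of a spherical code of minimal angle `60°`. -/
theorem exists_card_eq_kissingNumber (n : ℕ) : ∃ T : Finset (EuclideanSpace ℝ (Fin n)),
    T.card = kissingNumber n ∧ (∀ x ∈ T, ‖x‖ = 1) ∧
      ∀ x ∈ T, ∀ y ∈ T, x ≠ y → 1 ≤ dist x y := by
  classical
  obtain ⟨s, ⟨h1, h2⟩, hcard⟩ := (kissingNumber_isGreatest n).1
  have hinj : Function.Injective fun c : EuclideanSpace ℝ (Fin n) => (1 / 2 : ℝ) • c :=
    smul_right_injective _ (by norm_num)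
  refine ⟨s.image fun c => (1 / 2 : ℝ) • c, ?_, ?_, ?_⟩
  · rw [Finset.card_image_of_injective s hinj, hcard]
  · simp only [Finset.mem_image]
    rintro _ ⟨c, hc, rfl⟩
    obtain ⟨hdis, z, hz1, hz2⟩ := h1 c hc
    rw [disjoint_ball_ball_iff one_pos one_pos, dist_zero_right] at hdis
    rw [mem_closedBall] at hz1 hz2
    have := dist_triangle_left c 0 z
    rw [dist_zero_right c] at this
    rw [norm_smul, Real.norm_of_nonneg (by norm_num)]
    linarith
  · simp only [Finset.mem_image]
    rintro _ ⟨c, hc, rfl⟩ _ ⟨c', hc', rfl⟩ hne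
    have := h2 c hc c' hc' fun e => hne (by rw [e])
    rw [disjoint_ball_ball_iff one_pos one_pos] at this
    rw [dist_smul₀, Real.norm_of_nonneg (by norm_num)]
    linarith

/-- For `i = θn` and large `n` the coefficient tends to `θ(1 + θ) / (1 + 2θ)²`, which is `17 / 324`
at `θ = 1 / 16`. -/
theorem le_gegenbauerCoeff (hn : 3 ≤ n) {i : ℕ} (hi : n ≤ 16 * i) :
    17 / 324 ≤ gegenbauerCoeff n i := by
  have hn' : (3 : ℝ) ≤ n := by exact_mod_cast hn
  have hi' : (n : ℝ) ≤ 16 * i := by exact_mod_cast hi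
  have hi1 : (1 : ℝ) ≤ i := by
    have : 1 ≤ i := by omega
    exact_mod_cast this
  rw [gegenbauerCoeff, div_le_div_iff₀ (by norm_num) (mul_pos (by linarith) (by linarith))]
  nlinarith [mul_nonneg (sub_nonneg.2 hi') (by linarith : (0 : ℝ) ≤ 16 * i + 17 * n - 48)]

/-- One term of the expansion of `(1 + 16) ^ (n + i)`; the weight `16` suits `i` near `n / 16`. -/
theorem choose_mul_pow_le (n i : ℕ) (hn : 1 ≤ n) :
    ((n + i).choose (i + 1) : ℝ) * 16 ^ (n - 1) ≤ 17 ^ (n + i) := by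
  have h := add_pow (1 : ℕ) 16 (n + i)
  simp only [Nat.cast_id] at h
  have h1 := Finset.single_le_sum
    (f := fun m => 1 ^ m * 16 ^ (n + i - m) * (n + i).choose m)
    (fun m _ => Nat.zero_le _) (Finset.mem_range.2 (by omega : i + 1 < n + i + 1))
  rw [← h] at h1
  simp only [one_pow, one_mul] at h1
  rw [show n + i - (i + 1) = n - 1 by omega, mul_comm] at h1
  exact_mod_cast h1

/-- The first term is the averaging loss `log (ρ / h)`, the others the growth rate of the binomial
coefficient. The margin is below `10⁻⁴`, hence the precise bounds on logarithms. -/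
theorem exponent_lt :
    1 / 2 * Real.log (54191 / 50000) + 17 / 16 * Real.log 17 - Real.log 16 <
      0.4011 * Real.log 2 := by
  have exp_ge : ∀ c : ℝ, 0 ≤ c → 1 + c + c ^ 2 / 2 + c ^ 3 / 6 + c ^ 4 / 24 ≤ Real.exp c := by
    intro c hc
    have := Real.sum_le_exp_of_nonneg hc 5
    simp only [Finset.sum_range_succ, Finset.sum_range_zero, Nat.factorial] at this
    norm_num at this
    linarith
  have h1 : Real.log (17 / 16) ≤ 0.060625 := by
    rw [Real.log_le_iff_le_exp (by norm_num)]
    refine le_trans ?_ (exp_ge _ (by norm_num))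
    norm_num
  have h2 : Real.log (54191 / 50000) ≤ 0.0805 := by
    rw [Real.log_le_iff_le_exp (by norm_num)]
    refine le_trans ?_ (exp_ge _ (by norm_num))
    norm_num
  have h3 : Real.log 16 = 4 * Real.log 2 := by
    rw [show (16 : ℝ) = 2 ^ 4 by norm_num, Real.log_pow]
    norm_num
  rw [Real.log_div (by norm_num) (by norm_num), h3] at h1
  rw [h3]
  have := Real.log_two_gt_d9
  norm_num at h1 h2 this ⊢
  linarith

/-- The Kabatiansky–Levenshtein bound for the kissing number, with an additive constant in the
exponent. -/
theorem exists_log_kissingNumber_le : ∃ c : ℝ, ∀ n : ℕ, 3 ≤ n →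
    Real.log (kissingNumber n) ≤ c +
      n * (1 / 2 * Real.log (54191 / 50000) + 17 / 16 * Real.log 17 - Real.log 16) := by
  -- `0.22906` is just below `√(17 / 324)`, and `0.4581` just below its double.
  obtain ⟨K, hK, hcode⟩ := exists_card_le_mul_choose (s := 0.4581) (g := 0.22906) (by norm_num)
    (by norm_num) (by norm_num)
  -- With `Q = 10000 / 10838`, chosen so that `1 - 1 / (2Q) = 0.4581`, these are `a = 1 - Q` and `h²
  -- = Q(1 - Q)`: the segments from `(a, h)` to the origin and to `x` are orthogonal, which
  -- minimizes `(a² + h²) / h²` to `1 / Q = 1.0838`. The ratio `54191 / 50000 = 1.08382` leaves room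
  -- for the thickness `a / 10000`.
  set a : ℝ := 838 / 10838 with ha
  set h : ℝ := √(8380000 / 10838 ^ 2) with hh
  set ρ : ℝ := √(54191 / 50000 * h ^ 2) with hρ
  have hsq : h ^ 2 = 8380000 / 10838 ^ 2 := Real.sq_sqrt (by norm_num)
  have hhpos : 0 < h := Real.sqrt_pos.2 (by norm_num)
  have hρsq : ρ ^ 2 = 54191 / 50000 * h ^ 2 := Real.sq_sqrt (by positivity)
  have hρpos : 0 < ρ := Real.sqrt_pos.2 (by positivity)
  have hη : 0 < a / 10000 := by norm_num [ha]
  obtain ⟨N, hN⟩ := exists_nat_ge (2 * h / (a / 10000))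
  rw [div_le_iff₀ hη] at hN
  have hNpos : (0 : ℝ) < N := by
    by_contra! hneg
    nlinarith
  have hlogρ : Real.log ρ = 1 / 2 * Real.log (54191 / 50000) + Real.log h := by
    have h1 := congrArg Real.log hρsq
    rw [Real.log_pow, Real.log_mul (by norm_num) (by positivity), Real.log_pow] at h1
    push_cast at h1
    linarith
  refine ⟨Real.log N + Real.log K + Real.log 17 + Real.log 16, fun n hn => ?_⟩
  obtain ⟨T, hTcard, hT, hTd⟩ := exists_card_eq_kissingNumber n
  have hA : ∀ C : Finset (EuclideanSpace ℝ (Fin n)), (∀ x ∈ C, ‖x‖ = 1) →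
      (∀ x ∈ C, ∀ y ∈ C, x ≠ y → inner ℝ x y ≤ (0.4581 : ℝ)) →
      (C.card : ℝ) ≤ K * (17 ^ (n + (n / 16 + 1)) / 16 ^ (n - 1)) := by
    intro C hC hCs
    -- The `+ 1` compensates the rounding in `n / 16`, so that `n ≤ 16 * i` for all `i` from this
    -- degree on.
    refine (hcode n (n / 16 + 1) hn (by omega) (fun i hi => ?_) C hC hCs).trans ?_
    · refine le_trans (by norm_num) (le_gegenbauerCoeff hn (i := i) ?_)
      omega
    · refine mul_le_mul_of_nonneg_left ?_ hK.le
      rw [le_div_iff₀ (by positivity)]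
      exact choose_mul_pow_le n _ (by omega)
  have hmain := card_mul_pow_le_of_one_le_dist (a := a) (η := a / 10000) (h := h) (ρ := ρ)
    (Q := 10000 / 10838) (s := 0.4581) (by norm_num [ha]) hη hhpos.le hρpos.le
    (by rw [hρsq, hsq]; norm_num [ha]) (by norm_num [ha]) (by rw [hsq]; norm_num [ha])
    (by norm_num) (by norm_num) (by norm_num) hN hA T hT hTd
  rw [hTcard] at hmain
  have hτ : (0 : ℝ) < kissingNumber n := by
    exact_mod_cast one_le_kissingNumber (d := n) (by omega)
  have hlog := Real.log_le_log (by positivity) hmain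
  rw [Real.log_mul hτ.ne' (by positivity), Real.log_mul (by positivity) (by positivity),
    Real.log_mul hNpos.ne' (by positivity), Real.log_mul hK.ne' (by positivity),
    Real.log_div (by positivity) (by positivity), Real.log_pow, Real.log_pow, Real.log_pow,
    Real.log_pow, hlogρ] at hlog
  have hdiv : ((n / 16 : ℕ) : ℝ) ≤ n / 16 := Nat.cast_div_le
  have hcast : ((n - 1 : ℕ) : ℝ) = n - 1 := by rw [Nat.cast_sub (by omega), Nat.cast_one]
  rw [hcast] at hlog
  push_cast at hlog
  have hl17 : 0 ≤ Real.log 17 := Real.log_nonneg (by norm_num)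
  nlinarith [mul_le_mul_of_nonneg_right hdiv hl17]

theorem eventually_logb_kissingNumber_le :
    ∀ᶠ n : ℕ in atTop, Real.logb 2 (kissingNumber n) ≤ 0.4011 * n := by
  obtain ⟨c, hc⟩ := exists_log_kissingNumber_le
  have hlt := exponent_lt
  set β := 1 / 2 * Real.log (54191 / 50000) + 17 / 16 * Real.log 17 - Real.log 16
  have hδ : 0 < 0.4011 * Real.log 2 - β := sub_pos.2 hlt
  obtain ⟨n₀, hn₀⟩ := exists_nat_ge (c / (0.4011 * Real.log 2 - β))
  rw [div_le_iff₀ hδ] at hn₀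
  filter_upwards [eventually_ge_atTop n₀, eventually_ge_atTop 3] with n h1 h3
  have h1' : (n₀ : ℝ) ≤ n := by exact_mod_cast h1
  rw [Real.logb, div_le_iff₀ (Real.log_pos one_lt_two)]
  nlinarith [hc n h3, mul_le_mul_of_nonneg_right h1' hδ.le]

end KissingNumber

/-! ### Conclusion. -/

theorem theorem3p3 :
    ∃ ε : ℕ → ℝ, Tendsto ε atTop (𝓝 0) ∧
      (fun d : ℕ => 4 + 0.8022 * (d : ℝ) ^ 2 * (1 + ε d)) =O[atTop] (fun d : ℕ => (d : ℝ) ^ 2) ∧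
      ∀ d : ℕ, 1 ≤ d → ∀ r R : ℝ, 0 < r → 0 < R →
        (∀ X ∈ minClusterFamily d r R, ∀ x ∈ X, IsFullDimensional (cluster X x (2 * r))) ∧
        2 * (d * Real.logb 2 (kissingNumber d) + 2) * R ∈
          regularityRadii (minClusterFamily d r R) ∧
        regularityRadius (minClusterFamily d r R) ≤
          2 * (d * Real.logb 2 (kissingNumber d) + 2) * R ∧
        2 * (d * Real.logb 2 (kissingNumber d) + 2) * R ≤
          (4 + 0.8022 * (d : ℝ) ^ 2 * (1 + ε d)) * R := by
  -- The relative excess over the rate `0.4011 = 0.8022 / 2`: it makes the last inequality hold for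
  -- every `d ≥ 1` and vanishes for all large `d`.
  set ε : ℕ → ℝ := fun d => max 0 (Real.logb 2 (kissingNumber d) / (0.4011 * d) - 1) with hε
  have hε0 : ∀ᶠ d in atTop, ε d = 0 := by
    filter_upwards [eventually_logb_kissingNumber_le, eventually_ge_atTop 1] with d hd h1
    have h1' : (1 : ℝ) ≤ d := by exact_mod_cast h1
    refine max_eq_left ?_
    rw [sub_nonpos, div_le_one (by positivity)]
    exact hd
  refine ⟨ε, tendsto_const_nhds.congr' (hε0.mono fun d hd => hd.symm), ?_, ?_⟩
  · refine IsBigO.of_bound 5 ?_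
    filter_upwards [hε0, eventually_ge_atTop 1] with d hd h1
    have h1' : (1 : ℝ) ≤ d := by exact_mod_cast h1
    rw [hd, Real.norm_of_nonneg (by positivity), Real.norm_of_nonneg (by positivity)]
    nlinarith
  · intro d hd r R _ hR
    have hd' : (1 : ℝ) ≤ d := by exact_mod_cast hd
    have hlog : 0 ≤ Real.logb 2 (kissingNumber d) :=
      Real.logb_nonneg one_lt_two (by exact_mod_cast one_le_kissingNumber hd)
    have hmem : 2 * (d * Real.logb 2 (kissingNumber d) + 2) * R ∈
        regularityRadii (minClusterFamily d r R) :=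
      ⟨by positivity, fun X hX hiso => isRegularSystem_of_mem_minClusterFamily hd hX hiso⟩
    refine ⟨fun X hX x hx => isFullDimensional_of_mem_minClusterFamily hd hX hx, hmem,
      csInf_le ⟨0, fun ρ hρ => hρ.1.le⟩ hmem, ?_⟩
    refine mul_le_mul_of_nonneg_right ?_ hR.le
    have h1 : Real.logb 2 (kissingNumber d) / (0.4011 * d) - 1 ≤ ε d := le_max_right _ _
    have h2 : Real.logb 2 (kissingNumber d) ≤ (1 + ε d) * (0.4011 * d) := by
      rw [← div_le_iff₀ (by positivity)]
      linarith
    nlinarith [mul_le_mul_of_nonneg_left h2 (by positivity : (0 : ℝ) ≤ d)]
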